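/- **Setting.** Let $S^1=\mathbb R/\mathbb Z$, with normalized Lebesgue measure $\mathrm{Leb}$. For $x,y\in S^1$ let $[x,y]$ be the positively oriented segment from $x$ to $y$ and $|[x,y]|\in(0,1]$ its length, with the convention $|[x,x]|=1$; $\,]x,y[$ is the corresponding open segment, so that $]x,x[\,=S^1\setminus\{x\}$. Let $\mathcal G$ be the set of maps $g:S^1\to S^1$ that are induced by some right continuous nondecreasing $\tilde g:\mathbb R\to\mathbb R$ with $\tilde g(x+1)=\tilde g(x)+1$ (a lift of $g$), with the $\sigma$-algebra generated by the evaluations $g\mapsto g(t)$. Let $\beta>0$. The Dirichlet process $\mathbb Q^\beta$ is the probability measure on $\mathcal G$ such that for every $N\ge1$ and all $t_1,\dots,t_N\in S^1$ with $\sum_i|[t_i,t_{i+1}]|=1$ (where $t_{N+1}:=t_1$), the law of $(g(t_1),\dots,g(t_N))$ is $$\frac{\Gamma(\beta)}{\prod_{i=1}^N\Gamma(\beta|[t_i,t_{i+1}]|)}\prod_{i=1}^N|[x_i,x_{i+1}]|^{\beta|[t_i,t_{i+1}]|-1}\,dx_1\cdots dx_N$$ on $\{x\in(S^1)^N:\sum_i|[x_i,x_{i+1}]|=1\}$,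 where $x_{N+1}:=x_1$. Let $\mathcal P$ be the set of Borel probability measures on $S^1$, let $\chi:\mathcal G\to\mathcal P$, $\chi(g)=g_*\mathrm{Leb}$, and let the entropic measure be $\mathbb P^\beta=\chi_*\mathbb Q^\beta$. Let $h\in\mathcal G$ be a $C^2$-diffeomorphism of $S^1$ (that is, $h$ and $h^{-1}$ are of class $C^2$). For $g\in\mathcal G$ let $J_g$ be the set of jump locations in $S^1$ of (a lift of) $g$, and put $$X_h^\beta(g)=\exp\Big(\beta\int_0^1\log h'(g(s))\,ds\Big),\qquad Y_h^0(g)=\prod_{a\in J_g}\frac{\sqrt{h'(g(a-))\,h'(g(a+))}}{\dfrac{h(g(a+))-h(g(a-))}{g(a+)-g(a-)}},\qquad Y_h^\beta=X_h^\beta\,Y_h^0,$$ where differences are lengths of positively oriented segments. For $\mu\in\mathcal P$ let $\mathrm{gaps}(\mu)$ be the set of open segments $I=\,]I_-,I_+[$ with $\mu(I)=0$ that are maximal with this property, and put $$\bar Y_h^\beta(\mu)=\exp\Big(\beta\int_{S^1}\log h'(s)\,\mu(ds)\Big)\prod_{I\in\mathrm{gaps}(\mu)}\frac{\sqrt{h'(I_-)\,h'(I_+)}}{|h(I)|/|I|}.$$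 **Theorem.** 1. The map $\tau_h:\mathcal G\to\mathcal G$, $g\mapsto h\circ g$, is bijective; $h^{-1}$ is again a $C^2$-diffeomorphism in $\mathcal G$, and $\tau_h^{-1}=\tau_{h^{-1}}$. 2. The products defining $Y_h^0(g)$ and $\bar Y_h^\beta(\mu)$ converge (unconditionally) for all $g\in\mathcal G$ and all $\mu\in\mathcal P$, and $Y_h^\beta$ and $\bar Y_h^\beta$ are measurable. There is a constant $C=C(\beta,h)>0$ such that $1/C\le Y_h^\beta(g)\le C$ for all $g\in\mathcal G$. 3. $\mathbb Q^\beta$ is quasi-invariant under $\tau_h$, that is, $(\tau_h)_*\mathbb Q^\beta$ and $\mathbb Q^\beta$ are mutually absolutely continuous. More precisely, $d\mathbb Q^\beta(h\circ g)=Y_h^\beta(g)\,d\mathbb Q^\beta(g)$: the push forward $(\tau_{h^{-1}})_*\mathbb Q^\beta$ has density $Y_h^\beta$ with respect to $\mathbb Q^\beta$. 4. $Y_h^\beta(g)=\bar Y_h^\beta(\chi(g))$ for all $g\in\mathcal G$, and $\mathbb P^\beta$ is quasi-invariant under $\mu\mapsto h_*\mu$ (the image of $\mathbb P^\beta$ under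 this map and $\mathbb P^\beta$ are mutually absolutely continuous), with $d\mathbb P^\beta(h_*\mu)=\bar Y_h^\beta(\mu)\,d\mathbb P^\beta(\mu)$: the push forward of $\mathbb P^\beta$ under $\mu\mapsto(h^{-1})_*\mu$ has density $\bar Y_h^\beta$ with respect to $\mathbb P^\beta$. -/

import Mathlib

open MeasureTheory Set Filter Topology
open scoped ENNReal

/-! ### The circle `S¹ = ℝ / ℤ` (Mathlib's `UnitAddCircle`) -/

/-- The length `|[x, y]|` of the positively oriented segment from `x` to `y` in `ℝ / ℤ`. It takes
values in `(0, 1]`; a segment from a point to itself is one full turn, so that `∑ |[tᵢ, tᵢ₊₁]| = 1`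
also for a cyclic family consisting of a single point. -/
noncomputable def arcLength (x y : UnitAddCircle) : ℝ :=
  (AddCircle.equivIoc (1 : ℝ) 0 (y - x) : ℝ)

/-- The open positively oriented segment `]x, y[`; in particular `]x, x[` is the circle without
`x`. -/
def openArc (x y : UnitAddCircle) : Set UnitAddCircle :=
  {z | arcLength x z < arcLength x y}

/-- A cyclically ordered family of points of the circle (indices are cyclic: in `Fin (n + 1)` the
successor of the last index is `0`). By the convention for `arcLength`, its points are distinct. -/
def IsOrderedFamily {n : ℕ} (t : Fin (n + 1) → UnitAddCircle) : Prop :=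
  ∑ i, arcLength (t i) (t (i + 1)) = 1

/-! ### Monotone maps of the circle -/

/-- Right continuous nondecreasing maps `G : ℝ → ℝ` with `G (x + 1) = G x + 1`. -/
structure IsMonotoneLift (G : ℝ → ℝ) : Prop where
  mono : Monotone G
  rightCont : ∀ x, ContinuousWithinAt G (Ici x) x
  map_add_one : ∀ x, G (x + 1) = G x + 1

/-- `G` is a monotone lift to `ℝ` of the circle map `g`. -/
def IsLiftOf (G : ℝ → ℝ) (g : UnitAddCircle → UnitAddCircle) : Prop :=
  IsMonotoneLift G ∧ ∀ x : ℝ, g (x : UnitAddCircle) = (G x : UnitAddCircle)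

/-- The space `𝒢` of monotone maps of the circle: the maps induced by monotone lifts. -/
structure CircleMonotoneMap where
  toFun : UnitAddCircle → UnitAddCircle
  exists_lift : ∃ G : ℝ → ℝ, IsLiftOf G toFun

namespace CircleMonotoneMap

instance : CoeFun CircleMonotoneMap (fun _ => UnitAddCircle → UnitAddCircle) := ⟨toFun⟩

/-- The σ-algebra on `𝒢` generated by the evaluations `g ↦ g t`. -/
instance : MeasurableSpace CircleMonotoneMap :=
  MeasurableSpace.comap (fun (g : CircleMonotoneMap) (t : UnitAddCircle) => g t)
    MeasurableSpace.pi

/-- The identity map. -/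
def identity : CircleMonotoneMap :=
  ⟨fun x => x, fun x => x, ⟨monotone_id, fun _ => continuousWithinAt_id, fun _ => rfl⟩,
    fun _ => rfl⟩

/-- Composition of monotone maps of the circle. -/
def comp (h g : CircleMonotoneMap) : CircleMonotoneMap :=
  ⟨fun x => h (g x), by
    obtain ⟨H, hH, hHh⟩ := h.exists_lift
    obtain ⟨G, hG, hGg⟩ := g.exists_lift
    refine ⟨fun x => H (G x), ⟨hH.mono.comp hG.mono, fun x => ?_, fun x => ?_⟩, fun x => ?_⟩
    · exact ContinuousWithinAt.comp (hH.rightCont (G x)) (hG.rightCont x)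
        (fun y hy => hG.mono hy)
    · simp only [hG.map_add_one, hH.map_add_one]
    · simp only [hGg, hHh]⟩

/-- The translation `τ_h : 𝒢 → 𝒢`, `g ↦ h ∘ g`. -/
def translate (h : CircleMonotoneMap) : CircleMonotoneMap → CircleMonotoneMap :=
  fun g => h.comp g

/-- A monotone lift of `g`. It is unique up to an additive integer, except that a constant map `c`
has all the lifts `x ↦ c + ⌊x - a⌋`, which have one jump, of height `1`, in each period. None of
the quantities built from it below depends on the choice. -/
noncomputable def lift (g : CircleMonotoneMap) : ℝ → ℝ := Classical.choose g.exists_lift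

theorem lift_spec (g : CircleMonotoneMap) : IsLiftOf g.lift g := Classical.choose_spec g.exists_lift

/-- `h` is a `C²`-diffeomorphism of the circle: on the universal cover, `h` and an inverse of it
are given by functions of class `C²`. -/
def IsC2Diffeo (h : CircleMonotoneMap) : Prop :=
  ∃ H K : ℝ → ℝ, IsLiftOf H h ∧ ContDiff ℝ 2 H ∧ ContDiff ℝ 2 K ∧
    Function.LeftInverse K H ∧ Function.RightInverse K H

/-- The derivative `h' : S¹ → ℝ` (for differentiable `h`). -/
noncomputable def derivative (h : CircleMonotoneMap) (x : UnitAddCircle) : ℝ :=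
  deriv h.lift (AddCircle.equivIco (1 : ℝ) 0 x : ℝ)

theorem measurable_coe (g : CircleMonotoneMap) : Measurable (g : UnitAddCircle → UnitAddCircle) := by
  have h1 : (g : UnitAddCircle → UnitAddCircle) =
      fun x => (g.lift (AddCircle.equivIco (1 : ℝ) 0 x : ℝ) : UnitAddCircle) := by
    funext x
    rw [← g.lift_spec.2, AddCircle.coe_equivIco]
  rw [h1]
  exact AddCircle.measurable_mk'.comp (g.lift_spec.1.mono.measurable.comp
    (measurable_subtype_coe.comp (AddCircle.measurableEquivIco (1 : ℝ) 0).measurable))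

/-! ### The density -/

/-- The jump locations of `g`, represented in `[0, 1)`. -/
def jumps (g : CircleMonotoneMap) : Set ℝ :=
  {a | a ∈ Ico (0 : ℝ) 1 ∧ Function.leftLim g.lift a ≠ g.lift a}

/-- The factor `√(h'(g(a-)) h'(g(a+))) / (δ(h ∘ g)/δg)(a)` at a jump location `a` of `g`, where
`(δ(h ∘ g)/δg)(a) = (h(g(a+)) - h(g(a-))) / (g(a+) - g(a-))` and differences stand for lengths of
positively oriented segments. By right continuity `g(a+) = g(a)`. -/
noncomputable def jumpFactor (h g : CircleMonotoneMap) (a : ℝ) : ℝ :=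
  let u : ℝ := Function.leftLim g.lift a
  let v : ℝ := g.lift a
  √(h.derivative (u : UnitAddCircle) * h.derivative (v : UnitAddCircle)) /
    ((h.lift v - h.lift u) / (v - u))

/-- `Y⁰_h(g)`, the product of the jump factors over all jumps of `g`. -/
noncomputable def densityY0 (h g : CircleMonotoneMap) : ℝ :=
  ∏' a : g.jumps, jumpFactor h g a

/-- `X^β_h(g) = exp (β ∫ log h'(g(s)) ds)`. -/
noncomputable def densityX (β : ℝ) (h g : CircleMonotoneMap) : ℝ :=
  Real.exp (β * ∫ s : UnitAddCircle, Real.log (h.derivative (g s)))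

/-- `Y^β_h(g) = X^β_h(g) · Y⁰_h(g)`. -/
noncomputable def densityY (β : ℝ) (h g : CircleMonotoneMap) : ℝ :=
  densityX β h g * densityY0 h g

/-! ### Dirichlet process and entropic measure -/

/-- The law of `(g(t₀), …, g(tₙ))` prescribed for the Dirichlet process: the measure on `(S¹)ⁿ⁺¹`
which is concentrated on ordered families `x` and has there the density
`Γ(β) / ∏ Γ(β |[tᵢ, tᵢ₊₁]|) · ∏ |[xᵢ, xᵢ₊₁]| ^ (β |[tᵢ, tᵢ₊₁]| - 1)`
with respect to `dx₀ … dxₙ`. -/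
noncomputable def dirichletMarginal (β : ℝ) {n : ℕ} (t : Fin (n + 1) → UnitAddCircle) :
    Measure (Fin (n + 1) → UnitAddCircle) :=
  (volume.restrict {x | IsOrderedFamily x}).withDensity fun x =>
    ENNReal.ofReal
      (Real.Gamma β / (∏ i, Real.Gamma (β * arcLength (t i) (t (i + 1)))) *
        ∏ i, arcLength (x i) (x (i + 1)) ^ (β * arcLength (t i) (t (i + 1)) - 1))

/-- `Q` is the Dirichlet process `ℚ^β` on `𝒢`: the probability measure on `𝒢` with the prescribed
finite-dimensional distributions (these determine it uniquely). -/
structure IsDirichletProcess (β : ℝ) (Q : Measure CircleMonotoneMap) : Prop where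
  isProbabilityMeasure : IsProbabilityMeasure Q
  marginal : ∀ (n : ℕ) (t : Fin (n + 1) → UnitAddCircle), IsOrderedFamily t →
    Q.map (fun g i => g (t i)) = dirichletMarginal β t

/-- The action `μ ↦ h_* μ` on probability measures on the circle. -/
noncomputable def pushforward (h : CircleMonotoneMap) (μ : ProbabilityMeasure UnitAddCircle) :
    ProbabilityMeasure UnitAddCircle :=
  μ.map h.measurable_coe.aemeasurable

/-- Normalized Lebesgue measure on the circle. -/
noncomputable def leb : ProbabilityMeasure UnitAddCircle := ⟨volume, ⟨by
    simp [AddCircle.measure_univ]⟩⟩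

/-- The map `χ : 𝒢 → 𝒫(S¹)`, `g ↦ g_* Leb`. -/
noncomputable def chi (g : CircleMonotoneMap) : ProbabilityMeasure UnitAddCircle :=
  g.pushforward leb

/-- The push forward under `χ` of a measure on `𝒢`. For the Dirichlet process `ℚ^β` this is the
entropic measure `ℙ^β`. -/
noncomputable def entropicMeasure (Q : Measure CircleMonotoneMap) :
    Measure (ProbabilityMeasure UnitAddCircle) :=
  Q.map chi

/-- The gaps of `μ`: the open segments `]I₋, I₊[` of measure zero which are maximal, recorded as
the pair `(I₋, I₊)` of endpoints. -/
def gaps (μ : ProbabilityMeasure UnitAddCircle) : Set (UnitAddCircle × UnitAddCircle) :=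
  {I | (μ : Measure UnitAddCircle) (openArc I.1 I.2) = 0 ∧
    ∀ J : UnitAddCircle × UnitAddCircle, openArc I.1 I.2 ⊆ openArc J.1 J.2 →
      (μ : Measure UnitAddCircle) (openArc J.1 J.2) = 0 → J = I}

/-- The factor `√(h'(I₋) h'(I₊)) / (|h(I)| / |I|)` of a gap `I`. -/
noncomputable def gapFactor (h : CircleMonotoneMap) (I : UnitAddCircle × UnitAddCircle) : ℝ :=
  √(h.derivative I.1 * h.derivative I.2) /
    (arcLength (h I.1) (h I.2) / arcLength I.1 I.2)

/-- `exp (β ∫ log h' dμ) · ∏_{I ∈ gaps μ} √(h'(I₋) h'(I₊)) / (|h(I)| / |I|)`. -/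
noncomputable def entropicDensity (β : ℝ) (h : CircleMonotoneMap)
    (μ : ProbabilityMeasure UnitAddCircle) : ℝ :=
  Real.exp (β * ∫ s, Real.log (h.derivative s) ∂(μ : Measure UnitAddCircle)) *
    ∏' I : gaps μ, gapFactor h I

/-! ### Measurability of the maps used for push forwards -/

theorem measurable_eval (t : UnitAddCircle) : Measurable fun g : CircleMonotoneMap => g t :=
  (measurable_pi_apply t).comp (comap_measurable _)

theorem measurable_translate (h : CircleMonotoneMap) : Measurable h.translate :=
  Measurable.of_comap_le <| by
    rw [instMeasurableSpace, MeasurableSpace.comap_comp, ← measurable_iff_comap_le]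
    exact measurable_pi_lambda _ fun t => h.measurable_coe.comp (measurable_eval t)

theorem measurable_uncurry :
    Measurable fun p : CircleMonotoneMap × UnitAddCircle => p.1 p.2 := by
  let r : UnitAddCircle → ℝ := fun x => (AddCircle.equivIco (1 : ℝ) 0 x : ℝ)
  have hr : Measurable r :=
    measurable_subtype_coe.comp (AddCircle.measurableEquivIco (1 : ℝ) 0).measurable
  let s : ℕ → ℝ → ℝ := fun n x => ((⌊((n : ℝ) + 1) * x⌋ : ℝ) + 1) / ((n : ℝ) + 1)
  have hs : ∀ x, Tendsto (fun n => s n x) atTop (𝓝[≥] x) := by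
    intro x
    have hlow : ∀ n : ℕ, x ≤ s n x := fun n => by
      have hn : (0 : ℝ) < (n : ℝ) + 1 := by positivity
      rw [le_div_iff₀ hn, mul_comm]
      exact (Int.lt_floor_add_one _).le
    have hup : ∀ n : ℕ, s n x ≤ x + 1 / ((n : ℝ) + 1) := fun n => by
      have hn : (0 : ℝ) < (n : ℝ) + 1 := by positivity
      have h1 := Int.floor_le (((n : ℝ) + 1) * x)
      have h2 : 1 / ((n : ℝ) + 1) * ((n : ℝ) + 1) = 1 := one_div_mul_cancel hn.ne'
      rw [div_le_iff₀ hn]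
      linarith
    refine tendsto_nhdsWithin_iff.2 ⟨?_, Eventually.of_forall hlow⟩
    refine tendsto_of_tendsto_of_tendsto_of_le_of_le tendsto_const_nhds ?_ hlow hup
    simpa using (tendsto_const_nhds (x := x)).add
      (tendsto_one_div_add_atTop_nhds_zero_nat (𝕜 := ℝ))
  have hm : ∀ n : ℕ, Measurable fun p : CircleMonotoneMap × UnitAddCircle =>
      p.1 ((s n (r p.2) : ℝ) : UnitAddCircle) := by
    intro n
    have h1 : Measurable fun q : CircleMonotoneMap × ℤ =>
        q.1 ((((q.2 : ℝ) + 1) / ((n : ℝ) + 1) : ℝ) : UnitAddCircle) :=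
      measurable_from_prod_countable_left fun k =>
        measurable_eval ((((k : ℝ) + 1) / ((n : ℝ) + 1) : ℝ) : UnitAddCircle)
    have h2 : Measurable fun p : CircleMonotoneMap × UnitAddCircle =>
        (p.1, ⌊((n : ℝ) + 1) * r p.2⌋) :=
      measurable_fst.prodMk
        (Int.measurable_floor.comp (measurable_const.mul (hr.comp measurable_snd)))
    exact h1.comp h2
  refine measurable_of_tendsto_metrizable hm (tendsto_pi_nhds.2 fun p => ?_)
  have hp : p.1 p.2 = (p.1.lift (r p.2) : UnitAddCircle) := by
    rw [← p.1.lift_spec.2, AddCircle.coe_equivIco]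
  simp only [hp, p.1.lift_spec.2]
  exact ((AddCircle.continuous_mk' (1 : ℝ)).tendsto _).comp
    ((p.1.lift_spec.1.rightCont (r p.2)).tendsto.comp (hs (r p.2)))

theorem measurable_pushforward (h : CircleMonotoneMap) : Measurable h.pushforward := by
  refine Measurable.subtype_mk ?_
  exact (Measure.measurable_map _ h.measurable_coe).comp measurable_subtype_coe

theorem measurable_chi : Measurable chi := by
  refine Measurable.subtype_mk (Measure.measurable_of_measurable_coe _ fun A hA => ?_)
  have h1 : ∀ g : CircleMonotoneMap, Measure.map g (volume : Measure UnitAddCircle) A =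
      volume (Prod.mk g ⁻¹'
        ((fun p : CircleMonotoneMap × UnitAddCircle => p.1 p.2) ⁻¹' A)) := fun g => by
    rw [Measure.map_apply g.measurable_coe hA]; rfl
  have h2 := measurable_measure_prodMk_left (ν := (volume : Measure UnitAddCircle))
    (measurable_uncurry hA)
  exact (funext h1 : (fun g : CircleMonotoneMap => _) = _) ▸ h2

end CircleMonotoneMap

/-! ### Arcs of the circle -/

/-! Only the finite-dimensional laws of the Dirichlet process are explicit, so the density is found
on the grids `i / (n + 1)` and then refined. Changing variables by `h` in the law of the values `x
i` of `g` on a grid multiplies its density by `R = ∏ h'(x i) * ∏ (|[h (x i), h (x (i+1))]| / |[x i,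
x (i+1)]|) ^ (β / (n+1) - 1)`, which is `marginalRatio` (`IsC2Diffeo.map_dirichletMarginal`). Since
the family is cyclic, `∏ h'(x i) = ∏ √(h'(x i) h'(x (i+1)))`. Hence `R` is the product of `exp (β *
mean of the log slopes)` and of the factors `√(h'(x i) h'(x (i+1))) / slope`
(`IsC2Diffeo.marginalRatio_eq_exp`).

The mean of the log slopes tends to `∫ log h'(g s) ds`, because almost every `s` is a continuity
point of `g`. The second product is where `C²` enters. By the trapezoidal rule, `logFactor x y`, the
logarithm of such a factor, is `o(y - x)` near the diagonal, so `logFactorRate = logFactor / (y -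
x)` is continuous and vanishes on the diagonal. With `G` a lift of `g`, the sum of the logarithms is
a Stieltjes sum of this rate against `dG`. It converges to `∫ logFactorRate (G(s-), G(s)) dG(s)`;
the integrand is zero where `G` is continuous, so only the atoms of `dG` contribute, and they give
exactly the product over the jumps.

Everything is bounded uniformly in `g` and `n`, because `logFactorRate` is bounded above the
diagonal and `dG` has mass one per period. For an event determined by one grid, the change of
variables holds on all finer grids containing it; dominated convergence replaces `R` by `densityY`.
Such events form a π-system generating the σ-algebra, so `IsDirichletProcess.map_translate` follows,
and positivity of the density gives equivalence of the measures.

For the entropic measure, the jumps of `g` correspond to the gaps of `g_* Leb`, so the density is a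
function of `chi g`. The quantile map is a measurable right inverse of `chi`; through it convergence
and measurability pass to all probability measures. -/

theorem arcLength_pos (x y : UnitAddCircle) : 0 < arcLength x y :=
  (AddCircle.equivIoc (1 : ℝ) 0 (y - x)).2.1

theorem arcLength_le_one (x y : UnitAddCircle) : arcLength x y ≤ 1 := by
  simpa [arcLength] using (AddCircle.equivIoc (1 : ℝ) 0 (y - x)).2.2

theorem add_arcLength (x y : UnitAddCircle) : x + (arcLength x y : UnitAddCircle) = y := by
  unfold arcLength
  rw [AddCircle.coe_equivIoc]; abel

theorem arcLength_add {x : UnitAddCircle} {d : ℝ} (h0 : 0 < d) (h1 : d ≤ 1) :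
    arcLength x (x + (d : UnitAddCircle)) = d := by
  unfold arcLength
  rw [add_sub_cancel_left, AddCircle.equivIoc_coe_eq (p := (1 : ℝ)) (a := 0) ⟨h0, by simpa using h1⟩]

theorem arcLength_coe {x y : ℝ} (h0 : x < y) (h1 : y ≤ x + 1) :
    arcLength (x : UnitAddCircle) (y : UnitAddCircle) = y - x := by
  have h2 : (y : UnitAddCircle) = (x : UnitAddCircle) + ((y - x : ℝ) : UnitAddCircle) := by
    rw [← AddCircle.coe_add]; congr 1; ring
  rw [h2, arcLength_add (by linarith) (by linarith)]

theorem measurable_arcLength : Measurable fun p : UnitAddCircle × UnitAddCircle =>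
    arcLength p.1 p.2 :=
  measurable_subtype_coe.comp ((AddCircle.measurableEquivIoc (1 : ℝ) 0).measurable.comp
    (measurable_snd.sub measurable_fst))

theorem Measurable.arcLength {α : Type*} [MeasurableSpace α] {f g : α → UnitAddCircle}
    (hf : Measurable f) (hg : Measurable g) : Measurable fun a => arcLength (f a) (g a) :=
  (measurable_arcLength.comp (hf.prodMk hg) :)

theorem UnitAddCircle.coe_eq_coe_iff {x y : ℝ} :
    (x : UnitAddCircle) = y ↔ ∃ n : ℤ, y = x + n := by
  have h1 : (x : UnitAddCircle) = y ↔ ((y - x : ℝ) : UnitAddCircle) = 0 := by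
    rw [AddCircle.coe_sub, sub_eq_zero, eq_comm]
  rw [h1, AddCircle.coe_eq_zero_iff]
  refine exists_congr fun n => ?_
  simp only [zsmul_eq_mul, mul_one]
  constructor <;> intro h <;> linarith

theorem UnitAddCircle.exists_coe (p : UnitAddCircle) : ∃ x : ℝ, (x : UnitAddCircle) = p :=
  QuotientAddGroup.mk_surjective p

/-! ### Monotone lifts -/

namespace IsMonotoneLift

variable {G : ℝ → ℝ}

theorem map_add_int (hG : IsMonotoneLift G) (x : ℝ) (n : ℤ) : G (x + n) = G x + n := by
  induction n using Int.induction_on with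
  | zero => simp
  | succ k ih => push_cast at ih ⊢; rw [← add_assoc, hG.map_add_one, ih]; ring
  | pred k ih =>
    have h1 := hG.map_add_one (x + ((-(k : ℤ) - 1 : ℤ) : ℝ))
    push_cast at ih h1 ⊢
    rw [show x + (-(k : ℝ) - 1) + 1 = x + -(k : ℝ) by ring] at h1
    linarith

/-- A monotone lift as a Stieltjes function. -/
def stieltjes (hG : IsMonotoneLift G) : StieltjesFunction ℝ := ⟨G, hG.mono, hG.rightCont⟩

@[simp] theorem stieltjes_apply (hG : IsMonotoneLift G) (x : ℝ) : hG.stieltjes x = G x := rfl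

theorem leftLim_add_int (hG : IsMonotoneLift G) (x : ℝ) (n : ℤ) :
    Function.leftLim G (x + n) = Function.leftLim G x + n := by
  have h1 : Tendsto G (𝓝[<] (x + n)) (𝓝 (Function.leftLim G (x + n))) :=
    hG.mono.tendsto_leftLim _
  have h2 : Tendsto (fun y : ℝ => y + n) (𝓝[<] x) (𝓝[<] (x + n)) := by
    refine tendsto_nhdsWithin_iff.2 ⟨?_, ?_⟩
    · exact ((continuous_id.add continuous_const).tendsto x).mono_left nhdsWithin_le_nhds
    · filter_upwards [self_mem_nhdsWithin] with y hy
      simpa using hy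
  have h3 : Tendsto (fun y => G y + n) (𝓝[<] x) (𝓝 (Function.leftLim G x + n)) :=
    (hG.mono.tendsto_leftLim _).add tendsto_const_nhds
  refine tendsto_nhds_unique (h1.comp h2) (h3.congr fun y => ?_)
  exact (hG.map_add_int y n).symm

theorem sub_le_one (hG : IsMonotoneLift G) {x y : ℝ} (h : y ≤ x + 1) : G y - G x ≤ 1 := by
  have := hG.mono h
  rw [hG.map_add_one] at this
  linarith

theorem sub_leftLim_le_one (hG : IsMonotoneLift G) (x : ℝ) :
    G x - Function.leftLim G x ≤ 1 := by
  have h1 : G (x - 1) ≤ Function.leftLim G x := hG.mono.le_leftLim (by linarith)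
  have h2 := hG.map_add_one (x - 1)
  rw [sub_add_cancel] at h2
  linarith

end IsMonotoneLift

namespace CircleMonotoneMap

theorem ext_fun {g g' : CircleMonotoneMap} (h : ∀ x, g x = g' x) : g = g' := by
  cases g; cases g'; simp only [mk.injEq]; exact funext h

theorem coe_lift (g : CircleMonotoneMap) (x : ℝ) : (g.lift x : UnitAddCircle) = g x :=
  (g.lift_spec.2 x).symm

theorem _root_.IsMonotoneLift.coe_eq_coe {G : ℝ → ℝ} (hG : IsMonotoneLift G) {x y : ℝ}
    (hxy : (x : UnitAddCircle) = y) : (G x : UnitAddCircle) = G y := by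
  obtain ⟨n, rfl⟩ := UnitAddCircle.coe_eq_coe_iff.1 hxy
  exact UnitAddCircle.coe_eq_coe_iff.2 ⟨n, hG.map_add_int x n⟩

/-- The circle map induced by a monotone lift. -/
noncomputable def ofLift (G : ℝ → ℝ) (hG : IsMonotoneLift G) : CircleMonotoneMap :=
  ⟨fun x => (G (AddCircle.equivIco (1 : ℝ) 0 x : ℝ) : UnitAddCircle), G, hG,
    fun _ => hG.coe_eq_coe AddCircle.coe_equivIco⟩

theorem ofLift_coe {G : ℝ → ℝ} (hG : IsMonotoneLift G) (x : ℝ) :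
    ofLift G hG (x : UnitAddCircle) = G x :=
  hG.coe_eq_coe AddCircle.coe_equivIco

/-! ### Diffeomorphisms -/

variable {h : CircleMonotoneMap}

/-- Two lifts differ by an integer `n x` at each point. Strict monotonicity of `H` keeps its
increments over less than a period strictly between 0 and 1, which leaves no room for `n` to change.
This is what fails for constant maps. -/
theorem IsC2Diffeo.lift_eq_add {H K : ℝ → ℝ} (hH : IsLiftOf H h)
    (hK : Function.LeftInverse K H) : ∃ c : ℝ, ∀ x, h.lift x = H x + c := by
  have hs : StrictMono H := hH.1.mono.strictMono_of_injective hK.injective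
  have hn : ∀ x, ∃ n : ℤ, h.lift x = H x + n := fun x =>
    UnitAddCircle.coe_eq_coe_iff.1 (by rw [coe_lift, hH.2])
  choose n hn using hn
  have hl := h.lift_spec.1
  have key : ∀ x y, x < y → y < x + 1 → n x = n y := by
    intro x y h1 h2
    have h3 := hs h1
    have h4 := hs h2
    rw [hH.1.map_add_one] at h4
    have h5 := hl.mono h1.le
    have h6 := hl.sub_le_one h2.le
    rw [hn x, hn y] at h5 h6
    have h7 : (n y : ℝ) < n x + 1 := by linarith
    have h8 : (n x : ℝ) < n y + 1 := by linarith
    have h9 : n y < n x + 1 := by exact_mod_cast h7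
    have h10 : n x < n y + 1 := by exact_mod_cast h8
    omega
  have per : ∀ x (m : ℤ), n (x + m) = n x := by
    intro x m
    have h1 := hn (x + m)
    rw [hl.map_add_int, hH.1.map_add_int, hn x] at h1
    have : (n (x + m) : ℝ) = n x := by linarith
    exact_mod_cast this
  refine ⟨n 0, fun x => ?_⟩
  have h1 : n x = n 0 := by
    have h2 := per (Int.fract x) ⌊x⌋
    rw [Int.fract_add_floor] at h2
    rw [h2]
    rcases (Int.fract_nonneg x).eq_or_lt with h3 | h3
    · rw [← h3]
    · exact (key 0 _ h3 (by linarith [Int.fract_lt_one x])).symm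
  rw [hn x, h1]

theorem IsC2Diffeo.contDiff (hh : h.IsC2Diffeo) : ContDiff ℝ 2 h.lift := by
  obtain ⟨H, K, hH, h1, -, h2, -⟩ := hh
  obtain ⟨c, hc⟩ := IsC2Diffeo.lift_eq_add hH h2
  rw [funext hc]
  exact h1.add contDiff_const

theorem IsC2Diffeo.exists_inverse (hh : h.IsC2Diffeo) : ∃ K : ℝ → ℝ, ContDiff ℝ 2 K ∧
    Function.LeftInverse K h.lift ∧ Function.RightInverse K h.lift := by
  obtain ⟨H, K, hH, h1, h2, h3, h4⟩ := hh
  obtain ⟨c, hc⟩ := IsC2Diffeo.lift_eq_add hH h3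
  refine ⟨fun x => K (x - c), h2.comp (contDiff_id.sub contDiff_const), fun x => ?_, fun x => ?_⟩
  · simp [hc, h3 x]
  · simp [hc, h4 (x - c)]

theorem IsC2Diffeo.strictMono (hh : h.IsC2Diffeo) : StrictMono h.lift := by
  obtain ⟨K, -, h1, -⟩ := hh.exists_inverse
  exact h.lift_spec.1.mono.strictMono_of_injective h1.injective

theorem IsC2Diffeo.differentiable (hh : h.IsC2Diffeo) : Differentiable ℝ h.lift :=
  hh.contDiff.differentiable (by norm_num)

theorem IsC2Diffeo.contDiff_deriv (hh : h.IsC2Diffeo) : ContDiff ℝ 1 (deriv h.lift) := by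
  have h1 : ContDiff ℝ (1 + 1) h.lift := by
    have := hh.contDiff
    norm_num; exact this
  exact (contDiff_succ_iff_deriv.1 h1).2.2

theorem IsC2Diffeo.continuous (hh : h.IsC2Diffeo) : Continuous h.lift :=
  hh.contDiff.continuous

theorem IsC2Diffeo.deriv_pos (hh : h.IsC2Diffeo) (x : ℝ) : 0 < deriv h.lift x := by
  obtain ⟨K, hK, h1, -⟩ := hh.exists_inverse
  have h0 : 0 ≤ deriv h.lift x := h.lift_spec.1.mono.deriv_nonneg
  refine lt_of_le_of_ne h0 fun h2 => ?_
  have h3 : HasDerivAt (fun y => K (h.lift y)) (deriv K (h.lift x) * deriv h.lift x) x :=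
    ((hK.differentiable (by norm_num)) _).hasDerivAt.comp x (hh.differentiable x).hasDerivAt
  have h4 : (fun y => K (h.lift y)) = id := funext h1
  rw [h4, ← h2, mul_zero] at h3
  exact zero_ne_one (h3.unique (hasDerivAt_id x))

theorem deriv_lift_add_int (h : CircleMonotoneMap) (x : ℝ) (n : ℤ) :
    deriv h.lift (x + n) = deriv h.lift x := by
  have h1 : (fun y : ℝ => h.lift (y + n)) = fun y => h.lift y + n :=
    funext fun y => h.lift_spec.1.map_add_int y n
  rw [← deriv_comp_add_const h.lift (n : ℝ) x, h1, deriv_add_const]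

theorem derivative_coe (h : CircleMonotoneMap) (x : ℝ) :
    h.derivative (x : UnitAddCircle) = deriv h.lift x := by
  unfold derivative
  obtain ⟨n, hn⟩ := UnitAddCircle.coe_eq_coe_iff.1
    (AddCircle.coe_equivIco (p := (1 : ℝ)) (a := 0) (y := (x : UnitAddCircle))).symm
  rw [hn, deriv_lift_add_int]

theorem IsC2Diffeo.derivative_pos (hh : h.IsC2Diffeo) (x : UnitAddCircle) :
    0 < h.derivative x := hh.deriv_pos _

theorem measurable_derivative (h : CircleMonotoneMap) : Measurable h.derivative :=
  (measurable_deriv h.lift).comp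
    (measurable_subtype_coe.comp (AddCircle.measurableEquivIco (1 : ℝ) 0).measurable)

/-- The logarithm of the derivative of the lift. -/
noncomputable def logDeriv (h : CircleMonotoneMap) (x : ℝ) : ℝ := Real.log (deriv h.lift x)

theorem logDeriv_add_int (h : CircleMonotoneMap) (x : ℝ) (n : ℤ) :
    h.logDeriv (x + n) = h.logDeriv x := by
  rw [logDeriv, logDeriv, deriv_lift_add_int]

theorem log_derivative_coe (h : CircleMonotoneMap) (x : ℝ) :
    Real.log (h.derivative (x : UnitAddCircle)) = h.logDeriv x := by
  rw [derivative_coe, logDeriv]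

theorem IsC2Diffeo.contDiff_logDeriv (hh : h.IsC2Diffeo) : ContDiff ℝ 1 h.logDeriv :=
  hh.contDiff_deriv.log fun x => (hh.deriv_pos x).ne'

theorem exists_bound_of_periodic {f : ℝ → ℝ} (hf : Continuous f)
    (hp : ∀ x (n : ℤ), f (x + n) = f x) : ∃ C, 0 ≤ C ∧ ∀ x, |f x| ≤ C := by
  obtain ⟨C, hC⟩ := (isCompact_Icc (a := (0 : ℝ)) (b := 1)).exists_bound_of_continuousOn
    hf.continuousOn
  refine ⟨C, (norm_nonneg _).trans (hC 0 (by simp)), fun x => ?_⟩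
  have h1 := hp (Int.fract x) ⌊x⌋
  rw [Int.fract_add_floor] at h1
  rw [h1]
  exact hC _ ⟨Int.fract_nonneg x, (Int.fract_lt_one x).le⟩

theorem IsC2Diffeo.exists_bound_logDeriv (hh : h.IsC2Diffeo) :
    ∃ C, 0 ≤ C ∧ ∀ x, |h.logDeriv x| ≤ C :=
  exists_bound_of_periodic hh.contDiff_logDeriv.continuous h.logDeriv_add_int

theorem IsC2Diffeo.exists_lipschitz_logDeriv (hh : h.IsC2Diffeo) :
    ∃ C, 0 ≤ C ∧ ∀ x y, |h.logDeriv y - h.logDeriv x| ≤ C * |y - x| := by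
  have hd := hh.contDiff_logDeriv
  have hp : ∀ x (n : ℤ), deriv h.logDeriv (x + n) = deriv h.logDeriv x := fun x n => by
    rw [← deriv_comp_add_const h.logDeriv (n : ℝ) x]
    congr 1
    exact funext fun y => h.logDeriv_add_int y n
  obtain ⟨C, hC0, hC⟩ := exists_bound_of_periodic (hd.continuous_deriv (by norm_num)) hp
  refine ⟨C, hC0, fun x y => ?_⟩
  exact Convex.norm_image_sub_le_of_norm_deriv_le (𝕜 := ℝ) (s := univ)
    (fun z _ => (hd.differentiable (by norm_num)) z) (fun z _ => hC z) convex_univ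
    (mem_univ x) (mem_univ y)

/-- A `C²`-diffeomorphism has an inverse, which is again a `C²`-diffeomorphism. -/
theorem IsC2Diffeo.exists_inv (hh : h.IsC2Diffeo) : ∃ k : CircleMonotoneMap,
    k.comp h = identity ∧ h.comp k = identity ∧ k.IsC2Diffeo := by
  obtain ⟨K, hK, h1, h2⟩ := hh.exists_inverse
  have hmono : Monotone K := fun x y hxy => by
    by_contra! hc
    have := hh.strictMono hc
    rw [h2, h2] at this
    exact absurd hxy this.not_ge
  have hKl : IsMonotoneLift K := by
    refine ⟨hmono, fun x => hK.continuous.continuousWithinAt, fun x => ?_⟩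
    have h3 := h.lift_spec.1.map_add_one (K x)
    rw [h2] at h3
    rw [← h3, h1]
  refine ⟨ofLift K hKl, ext_fun fun p => ?_, ext_fun fun p => ?_, K, h.lift,
    ⟨hKl, ofLift_coe hKl⟩, hK, hh.contDiff, h2, h1⟩
  · obtain ⟨x, rfl⟩ := UnitAddCircle.exists_coe p
    change ofLift K hKl (h x) = x
    rw [← coe_lift, ofLift_coe, h1]
  · obtain ⟨x, rfl⟩ := UnitAddCircle.exists_coe p
    change h (ofLift K hKl x) = x
    rw [ofLift_coe, ← coe_lift, h2]

theorem IsC2Diffeo.arcLength_map (hh : h.IsC2Diffeo) {x y : ℝ} (h0 : x < y) (h1 : y ≤ x + 1) :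
    arcLength (h x) (h y) = h.lift y - h.lift x := by
  rw [← coe_lift, ← coe_lift]
  refine arcLength_coe (hh.strictMono h0) ?_
  rw [← h.lift_spec.1.map_add_one]
  exact h.lift_spec.1.mono h1

end CircleMonotoneMap

/-! ### The trapezoidal error of the logarithmic derivative -/

open Asymptotics in
/-- The difference quotient of a `C²` function is the mean of the derivatives at the endpoints, up
to an error of smaller order. -/
theorem isLittleO_slope_sub_mean {H : ℝ → ℝ} (hd : Differentiable ℝ H) {x₀ k : ℝ}
    (hk : HasStrictDerivAt (deriv H) k x₀) :
    (fun p : ℝ × ℝ => H p.2 - H p.1 - (deriv H p.1 + deriv H p.2) / 2 * (p.2 - p.1))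
      =o[𝓝 (x₀, x₀)] fun p => (p.2 - p.1) ^ 2 := by
  rw [isLittleO_iff]
  intro ε hε
  have h1 := isLittleO_iff.1 hk.isLittleO hε
  rw [nhds_prod_eq] at h1
  obtain ⟨U, hU, hUs⟩ := mem_prod_same_iff.1 h1
  obtain ⟨δ, hδ, hball⟩ := Metric.mem_nhds_iff.1 hU
  have hmem : Metric.ball x₀ δ ×ˢ Metric.ball x₀ δ ∈ 𝓝 (x₀, x₀) :=
    prod_mem_nhds (Metric.ball_mem_nhds _ hδ) (Metric.ball_mem_nhds _ hδ)
  filter_upwards [hmem] with p hp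
  obtain ⟨hp1, hp2⟩ := hp
  have hb : ∀ t ∈ Metric.ball x₀ δ, ∀ s ∈ Metric.ball x₀ δ,
      |deriv H t - deriv H s - k * (t - s)| ≤ ε * |t - s| := by
    intro t ht s hs
    have := hUs (show (t, s) ∈ U ×ˢ U from ⟨hball ht, hball hs⟩)
    simpa [mul_comm] using this
  set x := p.1
  set y := p.2
  -- The quadratic correction takes equal values at `x` and `y`, so the increment of this function
  -- over `[x, y]` is the trapezoidal error. Its derivative is the average of two
  -- strict-differentiability remainders, each at most `ε * |y - x|`.
  have hder : ∀ t, HasDerivAt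
      (fun t => H t - (deriv H x + deriv H y) / 2 * t - k * ((t - x) ^ 2 + (t - y) ^ 2) / 4)
      (((deriv H t - deriv H x - k * (t - x)) + (deriv H t - deriv H y - k * (t - y))) / 2) t := by
    intro t
    have e1 := (hd t).hasDerivAt
    have e2 := (hasDerivAt_id t).const_mul ((deriv H x + deriv H y) / 2)
    have e3 := ((((hasDerivAt_id t).sub_const x).pow 2).add
      (((hasDerivAt_id t).sub_const y).pow 2)).const_mul k |>.div_const 4
    refine ((e1.sub e2).sub e3).congr_deriv ?_
    simp only [id]; push_cast; ring
  have hseg : uIcc x y ⊆ Metric.ball x₀ δ := by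
    rw [← segment_eq_uIcc]
    exact (convex_ball x₀ δ).segment_subset hp1 hp2
  have key := Convex.norm_image_sub_le_of_norm_hasDerivWithin_le (s := uIcc x y)
    (C := ε * |y - x|) (fun t _ => (hder t).hasDerivWithinAt) (fun t ht => ?_)
    (convex_uIcc x y) left_mem_uIcc right_mem_uIcc
  · simp only [Real.norm_eq_abs] at key ⊢
    rw [abs_pow, pow_two, ← mul_assoc]
    refine le_trans (le_of_eq ?_) key
    congr 1; ring
  · have h2 := hb t (hseg ht) x hp1
    have h3 := hb t (hseg ht) y hp2
    have h4 : |t - x| ≤ |y - x| := by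
      exact abs_sub_left_of_mem_uIcc ht
    have h5 : |t - y| ≤ |y - x| := by
      rw [abs_sub_comm t y]; exact abs_sub_right_of_mem_uIcc ht
    rw [Real.norm_eq_abs, abs_div, abs_two, div_le_iff₀ two_pos]
    refine (abs_add_le _ _).trans ?_
    have := mul_le_mul_of_nonneg_left h4 hε.le
    have := mul_le_mul_of_nonneg_left h5 hε.le
    linarith

namespace CircleMonotoneMap

variable {h : CircleMonotoneMap}

/-- The logarithm of `√(h'(x) h'(y)) / ((h(y) - h(x)) / (y - x))`. -/
noncomputable def logFactor (h : CircleMonotoneMap) (x y : ℝ) : ℝ :=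
  Real.log (√(deriv h.lift x * deriv h.lift y) / ((h.lift y - h.lift x) / (y - x)))

theorem logFactor_self (h : CircleMonotoneMap) (x : ℝ) : h.logFactor x x = 0 := by
  simp [logFactor]

theorem IsC2Diffeo.slope_pos (hh : h.IsC2Diffeo) {x y : ℝ} (hxy : x ≠ y) :
    0 < (h.lift y - h.lift x) / (y - x) := by
  rcases hxy.lt_or_gt with h1 | h1
  · exact div_pos (sub_pos.2 (hh.strictMono h1)) (sub_pos.2 h1)
  · exact div_pos_of_neg_of_neg (sub_neg.2 (hh.strictMono h1)) (sub_neg.2 h1)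

theorem IsC2Diffeo.logFactor_eq (hh : h.IsC2Diffeo) {x y : ℝ} (hxy : x ≠ y) :
    h.logFactor x y = (h.logDeriv x + h.logDeriv y) / 2 -
      Real.log ((h.lift y - h.lift x) / (y - x)) := by
  have h1 := hh.deriv_pos x
  have h2 := hh.deriv_pos y
  rw [logFactor, Real.log_div (Real.sqrt_pos.2 (mul_pos h1 h2)).ne' (hh.slope_pos hxy).ne',
    Real.log_sqrt (mul_pos h1 h2).le, Real.log_mul h1.ne' h2.ne']
  rfl

/-- By the mean value theorem the slope is `h'(ξ)` with `ξ` between `x` and `y`, and `log h'` is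
Lipschitz. -/
theorem IsC2Diffeo.exists_slope_bound (hh : h.IsC2Diffeo) :
    ∃ C, 0 ≤ C ∧ ∀ x y, x < y →
      |Real.log ((h.lift y - h.lift x) / (y - x)) - h.logDeriv x| ≤ C * (y - x) ∧
      |Real.log ((h.lift y - h.lift x) / (y - x)) - h.logDeriv y| ≤ C * (y - x) := by
  obtain ⟨C, hC0, hC⟩ := hh.exists_lipschitz_logDeriv
  refine ⟨C, hC0, fun x y hxy => ?_⟩
  obtain ⟨ξ, hξ, h1⟩ := exists_deriv_eq_slope h.lift hxy hh.continuous.continuousOn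
    hh.differentiable.differentiableOn
  rw [← h1]
  change |h.logDeriv ξ - _| ≤ _ ∧ |h.logDeriv ξ - _| ≤ _
  obtain ⟨h2, h3⟩ := hξ
  constructor
  · refine (hC x ξ).trans (mul_le_mul_of_nonneg_left ?_ hC0)
    rw [abs_of_pos (by linarith)]; linarith
  · refine (hC y ξ).trans (mul_le_mul_of_nonneg_left ?_ hC0)
    rw [abs_of_neg (by linarith)]; linarith

theorem IsC2Diffeo.exists_logFactor_bound (hh : h.IsC2Diffeo) :
    ∃ C, 0 ≤ C ∧ ∀ x y, x ≤ y → |h.logFactor x y| ≤ C * (y - x) := by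
  obtain ⟨C, hC0, hC⟩ := hh.exists_slope_bound
  refine ⟨C, hC0, fun x y hxy => ?_⟩
  rcases hxy.eq_or_lt with rfl | hxy
  · simp [logFactor_self]
  obtain ⟨h1, h2⟩ := hC x y hxy
  rw [hh.logFactor_eq hxy.ne]
  rw [abs_le] at h1 h2 ⊢
  constructor <;> linarith

open Asymptotics in
-- Both endpoint derivatives differ from the slope `S` by `O(y - x)`. Linearising `log` at `c =
-- h'(x₀)` turns `logFactor` into `c⁻¹` times (mean of the derivatives minus `S`), up to `o(y - x)`,
-- and that difference is itself `o(y - x)` by the trapezoidal estimate.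
theorem IsC2Diffeo.logFactor_isLittleO (hh : h.IsC2Diffeo) (x₀ : ℝ) :
    (fun p : ℝ × ℝ => h.logFactor p.1 p.2) =o[𝓝 (x₀, x₀)] fun p => p.2 - p.1 := by
  have hk : HasStrictDerivAt (deriv h.lift) (deriv (deriv h.lift) x₀) x₀ :=
    hh.contDiff_deriv.contDiffAt.hasStrictDerivAt (by norm_num)
  set c := deriv h.lift x₀ with hc
  have hlog : HasStrictDerivAt Real.log c⁻¹ c := Real.hasStrictDerivAt_log (hh.deriv_pos x₀).ne'
  -- the difference quotient, extended to the diagonal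
  let S : ℝ × ℝ → ℝ := fun p => if p.1 = p.2 then deriv h.lift p.1 else
    (h.lift p.2 - h.lift p.1) / (p.2 - p.1)
  have hS0 : (fun p : ℝ × ℝ => S p - (deriv h.lift p.1 + deriv h.lift p.2) / 2)
      =o[𝓝 (x₀, x₀)] fun p => p.2 - p.1 := by
    have h1 := isLittleO_slope_sub_mean hh.differentiable hk
    rw [isLittleO_iff] at h1 ⊢
    intro ε hε
    filter_upwards [h1 hε] with p hp
    by_cases he : p.1 = p.2
    · simp [S, he]
    · have hne : p.2 - p.1 ≠ 0 := sub_ne_zero.2 (Ne.symm he)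
      simp only [S, if_neg he]
      have h2 : h.lift p.2 - h.lift p.1 - (deriv h.lift p.1 + deriv h.lift p.2) / 2 * (p.2 - p.1)
          = ((h.lift p.2 - h.lift p.1) / (p.2 - p.1) -
            (deriv h.lift p.1 + deriv h.lift p.2) / 2) * (p.2 - p.1) := by field_simp
      rw [h2, norm_mul, norm_pow, pow_two, ← mul_assoc] at hp
      exact le_of_mul_le_mul_right hp (norm_pos_iff.2 hne)
  have hfst : Tendsto (fun p : ℝ × ℝ => deriv h.lift p.1) (𝓝 (x₀, x₀)) (𝓝 c) :=
    (hh.contDiff_deriv.continuous.comp continuous_fst).tendsto _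
  have hsnd : Tendsto (fun p : ℝ × ℝ => deriv h.lift p.2) (𝓝 (x₀, x₀)) (𝓝 c) :=
    (hh.contDiff_deriv.continuous.comp continuous_snd).tendsto _
  have hdiff : (fun p : ℝ × ℝ => deriv h.lift p.2 - deriv h.lift p.1)
      =O[𝓝 (x₀, x₀)] fun p => p.2 - p.1 := by
    have := hk.hasStrictFDerivAt.isBigO_sub.comp_tendsto
      ((continuous_snd.prodMk continuous_fst).tendsto' (x₀, x₀) (x₀, x₀) rfl)
    exact this
  have hz : Tendsto (fun p : ℝ × ℝ => p.2 - p.1) (𝓝 (x₀, x₀)) (𝓝 0) :=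
    (continuous_snd.sub continuous_fst).tendsto' _ _ (by simp)
  have hS : Tendsto S (𝓝 (x₀, x₀)) (𝓝 c) := by
    have h1 := (hS0.trans_tendsto hz).add ((hfst.add hsnd).div_const 2)
    simpa using h1
  have hO1 : (fun p : ℝ × ℝ => deriv h.lift p.1 - S p) =O[𝓝 (x₀, x₀)] fun p => p.2 - p.1 :=
    (hS0.isBigO.neg_left.sub (hdiff.const_mul_left (1 / 2))).congr_left fun p => by ring
  have hO2 : (fun p : ℝ × ℝ => deriv h.lift p.2 - S p) =O[𝓝 (x₀, x₀)] fun p => p.2 - p.1 :=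
    (hS0.isBigO.neg_left.add (hdiff.const_mul_left (1 / 2))).congr_left fun p => by ring
  have hl1 := (hlog.isLittleO.comp_tendsto (hfst.prodMk_nhds hS)).trans_isBigO hO1
  have hl2 := (hlog.isLittleO.comp_tendsto (hsnd.prodMk_nhds hS)).trans_isBigO hO2
  have hsum := ((hl1.add hl2).const_mul_left (1 / 2)).sub (hS0.const_mul_left c⁻¹)
  refine hsum.congr' (Eventually.of_forall fun p => ?_) EventuallyEq.rfl
  by_cases he : p.1 = p.2
  · simp [S, he, logFactor_self]
  · simp only [S, Function.comp_apply, if_neg he, hh.logFactor_eq he, logDeriv,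
      ContinuousLinearMap.toSpanSingleton_apply, smul_eq_mul]
    ring

/-- The quotient of `logFactor` by the length of the segment. -/
noncomputable def logFactorRate (h : CircleMonotoneMap) (p : ℝ × ℝ) : ℝ :=
  h.logFactor p.1 p.2 / (p.2 - p.1)

theorem sub_mul_logFactorRate (h : CircleMonotoneMap) (x y : ℝ) :
    (y - x) * h.logFactorRate (x, y) = h.logFactor x y := by
  by_cases he : x = y
  · simp [he, logFactor_self]
  · have : y - x ≠ 0 := sub_ne_zero.2 (Ne.symm he)
    simp only [logFactorRate]; field_simp

/-- On the diagonal the quotient is `0 / 0 = 0`, which is precisely the limit given by the little-o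
estimate. -/
theorem IsC2Diffeo.continuous_logFactorRate (hh : h.IsC2Diffeo) :
    Continuous h.logFactorRate := by
  rw [continuous_iff_continuousAt]
  rintro ⟨x, y⟩
  by_cases he : x = y
  · subst he
    rw [ContinuousAt]
    simp only [logFactorRate, sub_self, div_zero]
    exact (hh.logFactor_isLittleO x).tendsto_div_nhds_zero
  · unfold logFactorRate logFactor
    have h1 := hh.contDiff_deriv.continuous
    have h2 := hh.continuous
    have h3 : y - x ≠ 0 := sub_ne_zero.2 (Ne.symm he)
    have h4 := (hh.slope_pos he).ne'
    have h5 := (Real.sqrt_pos.2 (mul_pos (hh.deriv_pos x) (hh.deriv_pos y))).ne'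
    refine ContinuousAt.div (ContinuousAt.log (ContinuousAt.div ?_ (ContinuousAt.div ?_ ?_ h3) h4)
      (div_ne_zero h5 h4)) ?_ h3 <;> fun_prop

theorem IsC2Diffeo.exists_logFactorRate_bound (hh : h.IsC2Diffeo) :
    ∃ C, 0 ≤ C ∧ ∀ x y, x ≤ y → |h.logFactorRate (x, y)| ≤ C := by
  obtain ⟨C, hC0, hC⟩ := hh.exists_logFactor_bound
  refine ⟨C, hC0, fun x y hxy => ?_⟩
  rcases hxy.eq_or_lt with rfl | h1
  · simpa [logFactorRate] using hC0
  · rw [logFactorRate, abs_div, abs_of_pos (sub_pos.2 h1), div_le_iff₀ (sub_pos.2 h1)]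
    exact hC x y hxy

end CircleMonotoneMap

/-! ### Riemann-Stieltjes sums over uniform partitions -/

/-- The left end of the interval `]i / (n + 1), (i + 1) / (n + 1)]` containing `s`. -/
noncomputable def gridLeft (n : ℕ) (s : ℝ) : ℝ := (⌈((n : ℝ) + 1) * s⌉ - 1 : ℝ) / ((n : ℝ) + 1)

/-- The right end of the interval `]i / (n + 1), (i + 1) / (n + 1)]` containing `s`. -/
noncomputable def gridRight (n : ℕ) (s : ℝ) : ℝ := (⌈((n : ℝ) + 1) * s⌉ : ℝ) / ((n : ℝ) + 1)

theorem gridLeft_lt (n : ℕ) (s : ℝ) : gridLeft n s < s := by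
  have hn : (0 : ℝ) < (n : ℝ) + 1 := by positivity
  rw [gridLeft, div_lt_iff₀ hn]
  linarith [Int.ceil_lt_add_one (((n : ℝ) + 1) * s)]

theorem le_gridRight (n : ℕ) (s : ℝ) : s ≤ gridRight n s := by
  have hn : (0 : ℝ) < (n : ℝ) + 1 := by positivity
  rw [gridRight, le_div_iff₀ hn, mul_comm]
  exact Int.le_ceil _

theorem gridRight_eq (n : ℕ) (s : ℝ) : gridRight n s = gridLeft n s + 1 / ((n : ℝ) + 1) := by
  rw [gridLeft, gridRight]; ring

theorem gridLeft_lt_gridRight (n : ℕ) (s : ℝ) : gridLeft n s < gridRight n s :=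
  (gridLeft_lt n s).trans_le (le_gridRight n s)

/-- Cells open on the left and closed on the right make the left ends approach strictly from below
and the right ends from above or with equality. A right continuous lift thus produces its left limit
and its value. -/
theorem tendsto_gridLeft (s : ℝ) : Tendsto (fun n => gridLeft n s) atTop (𝓝[<] s) := by
  refine tendsto_nhdsWithin_iff.2 ⟨?_, Eventually.of_forall fun n => gridLeft_lt n s⟩
  refine tendsto_of_tendsto_of_tendsto_of_le_of_le (g := fun n : ℕ => s - 1 / ((n : ℝ) + 1)) ?_
    tendsto_const_nhds (fun n => ?_) fun n => (gridLeft_lt n s).le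
  · simpa using (tendsto_const_nhds (x := s)).sub
      (tendsto_one_div_add_atTop_nhds_zero_nat (𝕜 := ℝ))
  · have := le_gridRight n s
    rw [gridRight_eq] at this
    exact sub_le_iff_le_add.2 this

theorem tendsto_gridRight (s : ℝ) : Tendsto (fun n => gridRight n s) atTop (𝓝[≥] s) := by
  refine tendsto_nhdsWithin_iff.2 ⟨?_, Eventually.of_forall fun n => le_gridRight n s⟩
  have h1 := ((tendsto_gridLeft s).mono_right nhdsWithin_le_nhds).add
    (tendsto_one_div_add_atTop_nhds_zero_nat (𝕜 := ℝ))
  simp only [← gridRight_eq, add_zero] at h1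
  exact h1

theorem ceil_eq_of_mem_Ioc {n i : ℕ} {s : ℝ}
    (hs : s ∈ Ioc ((i : ℝ) / ((n : ℝ) + 1)) (((i + 1 : ℕ) : ℝ) / ((n : ℝ) + 1))) :
    ⌈((n : ℝ) + 1) * s⌉ = (i : ℤ) + 1 := by
  have hn : (0 : ℝ) < (n : ℝ) + 1 := by positivity
  obtain ⟨h1, h2⟩ := hs
  rw [div_lt_iff₀ hn] at h1
  rw [le_div_iff₀ hn] at h2
  rw [Int.ceil_eq_iff]
  push_cast at h2 ⊢
  constructor <;> linarith

/-- The sum is exactly the integral over `(0, 1]` of the step function `φ (gridLeft n s) (gridRight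
n s)`, since `K.measure` gives each cell its increment of `K`. Dominated convergence applies because
the measure is finite and `φ` is bounded. -/
theorem StieltjesFunction.tendsto_sum_grid (K : StieltjesFunction ℝ) {φ : ℝ → ℝ → ℝ} {C : ℝ}
    (hφ : ∀ x y, x ≤ y → |φ x y| ≤ C) {F : ℝ → ℝ}
    (hF : ∀ᵐ s ∂K.measure.restrict (Ioc 0 1),
      Tendsto (fun n => φ (gridLeft n s) (gridRight n s)) atTop (𝓝 (F s))) :
    Tendsto (fun n : ℕ => ∑ i ∈ Finset.range (n + 1),
      (K (((i : ℝ) + 1) / ((n : ℝ) + 1)) - K ((i : ℝ) / ((n : ℝ) + 1))) *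
        φ ((i : ℝ) / ((n : ℝ) + 1)) (((i : ℝ) + 1) / ((n : ℝ) + 1)))
      atTop (𝓝 (∫ s in Ioc 0 1, F s ∂K.measure)) := by
  have hmeas : ∀ n : ℕ, Measurable fun s => φ (gridLeft n s) (gridRight n s) := fun n => by
    have h1 : Measurable fun z : ℤ => φ ((z - 1 : ℝ) / ((n : ℝ) + 1)) ((z : ℝ) / ((n : ℝ) + 1)) :=
      measurable_from_top
    exact h1.comp (Int.measurable_ceil.comp (measurable_const.mul measurable_id))
  have hfin : IsFiniteMeasure (K.measure.restrict (Ioc 0 1)) := ⟨by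
    rw [Measure.restrict_apply_univ, K.measure_Ioc]; exact ENNReal.ofReal_lt_top⟩
  have hlim := tendsto_integral_of_dominated_convergence (μ := K.measure.restrict (Ioc 0 1))
    (fun _ => C) (fun n => (hmeas n).aestronglyMeasurable) (integrable_const C)
    (fun n => Eventually.of_forall fun s => hφ _ _ (gridLeft_lt_gridRight n s).le) hF
  refine hlim.congr fun n => ?_
  have hn : (0 : ℝ) < (n : ℝ) + 1 := by positivity
  let a : ℕ → ℝ := fun i => (i : ℝ) / ((n : ℝ) + 1)
  have ha : ∀ i, a i ≤ a (i + 1) := fun i => by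
    simp only [a]; gcongr; linarith
  have hint : ∀ k < n + 1, IntervalIntegrable (fun s => φ (gridLeft n s) (gridRight n s))
      K.measure (a k) (a (k + 1)) := fun k _ => by
    rw [intervalIntegrable_iff_integrableOn_Ioc_of_le (ha k)]
    refine Measure.integrableOn_of_bounded (M := C) ?_ (hmeas n).aestronglyMeasurable
      (Eventually.of_forall fun s => hφ _ _ (gridLeft_lt_gridRight n s).le)
    rw [K.measure_Ioc]; exact ENNReal.ofReal_ne_top
  have h0 : a 0 = 0 := by simp [a]
  have h1 : a (n + 1) = 1 := by simp only [a]; push_cast; exact div_self hn.ne'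
  have hsum := intervalIntegral.sum_integral_adjacent_intervals hint
  rw [h0, h1, intervalIntegral.integral_of_le zero_le_one] at hsum
  rw [← hsum]
  refine Finset.sum_congr rfl fun i _ => ?_
  rw [intervalIntegral.integral_of_le (ha i)]
  have hc : EqOn (fun s => φ (gridLeft n s) (gridRight n s))
      (fun _ => φ ((i : ℝ) / ((n : ℝ) + 1)) (((i : ℝ) + 1) / ((n : ℝ) + 1)))
      (Ioc (a i) (a (i + 1))) := fun s hs => by
    have := ceil_eq_of_mem_Ioc hs
    simp only [gridLeft, gridRight, this]
    push_cast
    rw [add_sub_cancel_right]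
  rw [setIntegral_congr_fun measurableSet_Ioc hc, setIntegral_const, smul_eq_mul, Measure.real,
    K.measure_Ioc, ENNReal.toReal_ofReal (sub_nonneg.2 (K.mono (ha i)))]
  simp only [a]; push_cast; rfl

namespace IsMonotoneLift

variable {G : ℝ → ℝ}

theorem tendsto_gridLeft (hG : IsMonotoneLift G) (s : ℝ) :
    Tendsto (fun n => G (gridLeft n s)) atTop (𝓝 (Function.leftLim G s)) :=
  (hG.mono.tendsto_leftLim s).comp (_root_.tendsto_gridLeft s)

theorem tendsto_gridRight (hG : IsMonotoneLift G) (s : ℝ) :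
    Tendsto (fun n => G (gridRight n s)) atTop (𝓝 (G s)) :=
  (hG.rightCont s).tendsto.comp (_root_.tendsto_gridRight s)

/-- The jump locations of a monotone lift in `[0, 1)`. -/
def jumpSet (G : ℝ → ℝ) : Set ℝ := {a | a ∈ Ico (0 : ℝ) 1 ∧ Function.leftLim G a ≠ G a}

theorem countable_jumpSet (hG : IsMonotoneLift G) : (jumpSet G).Countable :=
  (hG.stieltjes.countable_leftLim_ne).mono fun _ ha => ha.2

theorem measure_singleton_toReal (hG : IsMonotoneLift G) (a : ℝ) :
    (hG.stieltjes.measure {a}).toReal = G a - Function.leftLim G a := by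
  rw [StieltjesFunction.measure_singleton]
  exact ENNReal.toReal_ofReal (sub_nonneg.2 (hG.mono.leftLim_le le_rfl))

/-- Periodic functions have the same integral over `(0, 1]` and `[0, 1)`. -/
theorem setIntegral_Ioc_eq_Ico (hG : IsMonotoneLift G) {F : ℝ → ℝ} (hF : F 1 = F 0)
    (hint : IntegrableOn F (Icc 0 1) hG.stieltjes.measure) :
    ∫ s in Ioc 0 1, F s ∂hG.stieltjes.measure = ∫ s in Ico 0 1, F s ∂hG.stieltjes.measure := by
  -- The Stieltjes sums live on `(0, 1]` and the jumps are indexed by `[0, 1)`. The endpoints 0 and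
  -- 1 carry atoms of equal mass by periodicity.
  have h1 : hG.stieltjes.measure {1} = hG.stieltjes.measure {0} := by
    rw [StieltjesFunction.measure_singleton, StieltjesFunction.measure_singleton]
    have e1 := hG.map_add_int 0 1
    have e2 := hG.leftLim_add_int 0 1
    norm_num at e1 e2
    change ENNReal.ofReal (G 1 - Function.leftLim G 1) = ENNReal.ofReal (G 0 - Function.leftLim G 0)
    rw [e1, e2]; congr 1; ring
  rw [← Ioo_union_right one_pos, ← Ioo_union_left one_pos,
    setIntegral_union (by simp) (measurableSet_singleton _)
      (hint.mono_set Ioo_subset_Icc_self) (hint.mono_set (by simp)),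
    setIntegral_union (by simp) (measurableSet_singleton _)
      (hint.mono_set Ioo_subset_Icc_self) (hint.mono_set (by simp)),
    integral_singleton, integral_singleton, hF, Measure.real, Measure.real, h1]

end IsMonotoneLift

/-! ### The product over the jumps as a Stieltjes integral -/

namespace CircleMonotoneMap

variable {h : CircleMonotoneMap}

theorem countable_jumps (g : CircleMonotoneMap) : g.jumps.Countable :=
  g.lift_spec.1.countable_jumpSet

theorem log_jumpFactor (h g : CircleMonotoneMap) (a : ℝ) :
    Real.log (h.jumpFactor g a) = h.logFactor (Function.leftLim g.lift a) (g.lift a) := by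
  simp only [jumpFactor, derivative_coe, logFactor]

theorem leftLim_lift_le (g : CircleMonotoneMap) (a : ℝ) : Function.leftLim g.lift a ≤ g.lift a :=
  g.lift_spec.1.mono.leftLim_le le_rfl

theorem leftLim_lift_lt {g : CircleMonotoneMap} {a : ℝ} (ha : a ∈ g.jumps) :
    Function.leftLim g.lift a < g.lift a := lt_of_le_of_ne (g.leftLim_lift_le a) ha.2

theorem IsC2Diffeo.jumpFactor_pos (hh : h.IsC2Diffeo) {g : CircleMonotoneMap} {a : ℝ}
    (ha : a ∈ g.jumps) : 0 < h.jumpFactor g a := by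
  simp only [jumpFactor, derivative_coe]
  exact div_pos (Real.sqrt_pos.2 (mul_pos (hh.deriv_pos _) (hh.deriv_pos _)))
    (hh.slope_pos (leftLim_lift_lt ha).ne)

theorem logFactor_add_int (h : CircleMonotoneMap) (x y : ℝ) (n : ℤ) :
    h.logFactor (x + n) (y + n) = h.logFactor x y := by
  rw [logFactor, logFactor, deriv_lift_add_int, deriv_lift_add_int, h.lift_spec.1.map_add_int,
    h.lift_spec.1.map_add_int]
  congr 3 <;> ring

theorem logFactorRate_add_int (h : CircleMonotoneMap) (x y : ℝ) (n : ℤ) :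
    h.logFactorRate (x + n, y + n) = h.logFactorRate (x, y) := by
  simp only [logFactorRate, logFactor_add_int]
  congr 1; ring

/-- The Riemann sums for the logarithm of `Y⁰_h(g)`. -/
noncomputable def logFactorSum (h g : CircleMonotoneMap) (n : ℕ) : ℝ :=
  ∑ i ∈ Finset.range (n + 1), h.logFactor (g.lift ((i : ℝ) / ((n : ℝ) + 1)))
    (g.lift (((i : ℝ) + 1) / ((n : ℝ) + 1)))

/-- Each term is at most a constant times the increment of the lift, and the increments over one
period telescope to 1. So the bound depends neither on `g` nor on `n`. -/
theorem IsC2Diffeo.exists_logFactorSum_bound (hh : h.IsC2Diffeo) :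
    ∃ C, 0 ≤ C ∧ ∀ g n, |h.logFactorSum g n| ≤ C := by
  obtain ⟨C, hC0, hC⟩ := hh.exists_logFactor_bound
  refine ⟨C, hC0, fun g n => ?_⟩
  have hn : (0 : ℝ) < (n : ℝ) + 1 := by positivity
  refine (Finset.abs_sum_le_sum_abs _ _).trans ((Finset.sum_le_sum fun i _ =>
    hC _ _ (g.lift_spec.1.mono (by gcongr; linarith))).trans ?_)
  rw [← Finset.mul_sum]
  have h1 := Finset.sum_range_sub (fun i : ℕ => g.lift ((i : ℝ) / ((n : ℝ) + 1))) (n + 1)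
  push_cast at h1
  rw [h1, div_self hn.ne', zero_div]
  have h2 := g.lift_spec.1.map_add_one 0
  rw [zero_add] at h2
  rw [h2]; linarith

/-- The integrand representing the sum over the jumps as a Stieltjes integral. -/
noncomputable def jumpRate (h g : CircleMonotoneMap) (s : ℝ) : ℝ :=
  h.logFactorRate (Function.leftLim g.lift s, g.lift s)

theorem IsC2Diffeo.tendsto_logFactorSum_integral (hh : h.IsC2Diffeo) (g : CircleMonotoneMap) :
    Tendsto (h.logFactorSum g) atTop
      (𝓝 (∫ s in Ioc 0 1, h.jumpRate g s ∂g.lift_spec.1.stieltjes.measure)) := by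
  obtain ⟨C, hC0, hC⟩ := hh.exists_logFactorRate_bound
  have hG := g.lift_spec.1
  have h1 := hG.stieltjes.tendsto_sum_grid
    (φ := fun x y => h.logFactorRate (g.lift x, g.lift y)) (F := h.jumpRate g)
    (fun x y hxy => hC _ _ (hG.mono hxy)) (Eventually.of_forall fun s =>
      (hh.continuous_logFactorRate.tendsto _).comp
        ((hG.tendsto_gridLeft s).prodMk_nhds (hG.tendsto_gridRight s)))
  refine h1.congr fun n => Finset.sum_congr rfl fun i _ => ?_
  simp only [IsMonotoneLift.stieltjes_apply, sub_mul_logFactorRate]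

theorem IsC2Diffeo.integrableOn_jumpRate (hh : h.IsC2Diffeo) (g : CircleMonotoneMap) :
    IntegrableOn (h.jumpRate g) (Icc 0 1) g.lift_spec.1.stieltjes.measure := by
  obtain ⟨C, hC0, hC⟩ := hh.exists_logFactorRate_bound
  have hG := g.lift_spec.1
  refine Measure.integrableOn_of_bounded (M := C) ?_ ?_
    (Eventually.of_forall fun s => hC _ _ (g.leftLim_lift_le s))
  · rw [StieltjesFunction.measure_Icc]; exact ENNReal.ofReal_ne_top
  · exact (hh.continuous_logFactorRate.measurable.comp
      (hG.mono.leftLim.measurable.prodMk hG.mono.measurable)).aestronglyMeasurable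

theorem jumpRate_eq_zero (h g : CircleMonotoneMap) {s : ℝ}
    (hs : Function.leftLim g.lift s = g.lift s) : h.jumpRate g s = 0 := by
  simp [jumpRate, logFactorRate, hs]

/-- The integrand vanishes off the countable set of jumps. At a jump, the atom has mass `g(a) -
g(a-)`, and this times the rate is the logarithm of the jump factor. -/
theorem IsC2Diffeo.integral_jumpRate (hh : h.IsC2Diffeo) (g : CircleMonotoneMap) :
    ∫ s in Ioc 0 1, h.jumpRate g s ∂g.lift_spec.1.stieltjes.measure =
      ∑' a : g.jumps, Real.log (h.jumpFactor g a) := by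
  have hG := g.lift_spec.1
  have hint := hh.integrableOn_jumpRate g
  have hper : h.jumpRate g 1 = h.jumpRate g 0 := by
    have e1 := hG.map_add_int 0 1
    have e2 := hG.leftLim_add_int 0 1
    have e3 := h.logFactorRate_add_int (Function.leftLim g.lift 0) (g.lift 0) 1
    simp only [zero_add, Int.cast_one] at e1 e2 e3
    rw [jumpRate, jumpRate, e1, e2, e3]
  rw [hG.setIntegral_Ioc_eq_Ico hper hint,
    setIntegral_eq_of_subset_of_forall_sdiff_eq_zero measurableSet_Ico
      (fun a (ha : a ∈ g.jumps) => ha.1) (fun s hs => ?_),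
    setIntegral_countable _ g.countable_jumps
      (hint.mono_set fun a (ha : a ∈ g.jumps) => Ico_subset_Icc_self ha.1)]
  · refine tsum_congr fun a => ?_
    rw [log_jumpFactor, Measure.real, hG.measure_singleton_toReal, smul_eq_mul]
    exact h.sub_mul_logFactorRate _ _
  · exact h.jumpRate_eq_zero g (by_contra fun hc => hs.2 ⟨hs.1, hc⟩)

/-- The jump lengths are masses of distinct atoms of the Stieltjes measure, which is finite on `[0,
1]`. -/
theorem summable_jump_length (g : CircleMonotoneMap) :
    Summable fun a : g.jumps => g.lift a - Function.leftLim g.lift a := by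
  have hG := g.lift_spec.1
  have hc : Countable g.jumps := g.countable_jumps.to_subtype
  have h1 : ∑' a : g.jumps, hG.stieltjes.measure {(a : ℝ)} ≠ ⊤ := by
    rw [← measure_iUnion (fun a b hab => by simpa [Subtype.ext_iff] using hab)
      (fun a => measurableSet_singleton _)]
    refine ne_top_of_le_ne_top ?_ (measure_mono (t := Icc (0 : ℝ) 1) ?_)
    · rw [StieltjesFunction.measure_Icc]; exact ENNReal.ofReal_ne_top
    · exact iUnion_subset fun a => by simpa using Ico_subset_Icc_self a.2.1
  refine (ENNReal.summable_toReal h1).congr fun a => ?_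
  exact hG.measure_singleton_toReal _

theorem IsC2Diffeo.summable_log_jumpFactor (hh : h.IsC2Diffeo) (g : CircleMonotoneMap) :
    Summable fun a : g.jumps => Real.log (h.jumpFactor g a) := by
  obtain ⟨C, hC0, hC⟩ := hh.exists_logFactor_bound
  refine Summable.of_norm_bounded (g.summable_jump_length.mul_left C) fun a => ?_
  rw [log_jumpFactor]
  exact hC _ _ (g.leftLim_lift_le _)

theorem IsC2Diffeo.multipliable_jumpFactor (hh : h.IsC2Diffeo) (g : CircleMonotoneMap) :
    Multipliable fun a : g.jumps => h.jumpFactor g a :=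
  Real.multipliable_of_summable_log (fun a => hh.jumpFactor_pos a.2) (hh.summable_log_jumpFactor g)

theorem IsC2Diffeo.densityY0_eq_exp (hh : h.IsC2Diffeo) (g : CircleMonotoneMap) :
    densityY0 h g = Real.exp (∑' a : g.jumps, Real.log (h.jumpFactor g a)) :=
  (Real.rexp_tsum_eq_tprod (fun a => hh.jumpFactor_pos a.2) (hh.summable_log_jumpFactor g)).symm

theorem IsC2Diffeo.tendsto_exp_logFactorSum (hh : h.IsC2Diffeo) (g : CircleMonotoneMap) :
    Tendsto (fun n => Real.exp (h.logFactorSum g n)) atTop (𝓝 (densityY0 h g)) := by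
  rw [hh.densityY0_eq_exp, ← hh.integral_jumpRate]
  exact (Real.continuous_exp.tendsto _).comp (hh.tendsto_logFactorSum_integral g)

theorem IsC2Diffeo.exists_densityY_bound (hh : h.IsC2Diffeo) {β : ℝ} (hβ : 0 < β) :
    ∃ C : ℝ, 0 < C ∧ ∀ g : CircleMonotoneMap, 1 / C ≤ densityY β h g ∧ densityY β h g ≤ C := by
  obtain ⟨A, hA0, hA⟩ := hh.exists_bound_logDeriv
  obtain ⟨B, hB0, hB⟩ := hh.exists_logFactorSum_bound
  -- `A` bounds `|log h'|`, hence its integral along `g`; `B` bounds all the Riemann sums, hence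
  -- their limit.
  refine ⟨Real.exp (β * A + B), Real.exp_pos _, fun g => ?_⟩
  have h1 : |∑' a : g.jumps, Real.log (h.jumpFactor g a)| ≤ B := by
    rw [← hh.integral_jumpRate]
    exact le_of_tendsto (hh.tendsto_logFactorSum_integral g).abs
      (Eventually.of_forall fun n => hB g n)
  have h2 : |∫ s : UnitAddCircle, Real.log (h.derivative (g s))| ≤ A := by
    have := norm_integral_le_of_norm_le_const (μ := (volume : Measure UnitAddCircle)) (C := A)
      (f := fun s => Real.log (h.derivative (g s))) (Eventually.of_forall fun s => hA _)
    simpa [Measure.real, AddCircle.measure_univ] using this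
  rw [densityY, densityX, hh.densityY0_eq_exp, ← Real.exp_add, one_div, ← Real.exp_neg,
    Real.exp_le_exp, Real.exp_le_exp]
  rw [abs_le] at h1 h2
  constructor <;> nlinarith

end CircleMonotoneMap

namespace CircleMonotoneMap

variable {h : CircleMonotoneMap}

/-! ### Measurability of the density -/

theorem IsC2Diffeo.gapFactor_coe (hh : h.IsC2Diffeo) {x y : ℝ} (h0 : x < y) (h1 : y ≤ x + 1) :
    h.gapFactor ((x : UnitAddCircle), (y : UnitAddCircle)) =
      √(deriv h.lift x * deriv h.lift y) / ((h.lift y - h.lift x) / (y - x)) := by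
  simp only [gapFactor, derivative_coe, hh.arcLength_map h0 h1, arcLength_coe h0 h1]

theorem IsC2Diffeo.log_gapFactor_coe (hh : h.IsC2Diffeo) {x y : ℝ} (h0 : x < y)
    (h1 : y ≤ x + 1) :
    Real.log (h.gapFactor ((x : UnitAddCircle), (y : UnitAddCircle))) = h.logFactor x y := by
  rw [hh.gapFactor_coe h0 h1, logFactor]

theorem measurable_gapFactor (h : CircleMonotoneMap) : Measurable h.gapFactor := by
  unfold gapFactor
  have h1 := h.measurable_derivative
  have h2 := (h.measurable_coe.comp measurable_fst).arcLength (h.measurable_coe.comp measurable_snd)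
  exact ((h1.comp measurable_fst).mul (h1.comp measurable_snd)).sqrt.div
    (h2.div measurable_arcLength)

/-- Over a full turn the slope is 1 and both endpoint derivatives agree, so the factor is `h'(x)`.
This is the only factor of a constant map. -/
theorem logFactor_add_one (h : CircleMonotoneMap) (x : ℝ) :
    h.logFactor x (x + 1) = h.logDeriv x := by
  have h1 := h.deriv_lift_add_int x 1
  have h0 : 0 ≤ deriv h.lift x := h.lift_spec.1.mono.deriv_nonneg
  rw [Int.cast_one] at h1
  rw [logFactor, h1, h.lift_spec.1.map_add_one, Real.sqrt_mul_self h0]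
  simp [logDeriv]

section Grid

variable (g : CircleMonotoneMap) (n : ℕ)

theorem lift_grid_le {i j : ℕ} (hij : i ≤ j) :
    g.lift ((i : ℝ) / ((n : ℝ) + 1)) ≤ g.lift ((j : ℝ) / ((n : ℝ) + 1)) :=
  g.lift_spec.1.mono (by gcongr)

theorem lift_grid_last :
    g.lift (((n + 1 : ℕ) : ℝ) / ((n : ℝ) + 1)) = g.lift (((0 : ℕ) : ℝ) / ((n : ℝ) + 1)) + 1 := by
  have hn : (n : ℝ) + 1 ≠ 0 := by positivity
  have h1 := g.lift_spec.1.map_add_one 0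
  push_cast
  rw [div_self hn, zero_div, ← h1, zero_add]

theorem lift_grid_sub_le_one (i : ℕ) : g.lift (((i + 1 : ℕ) : ℝ) / ((n : ℝ) + 1)) -
    g.lift ((i : ℝ) / ((n : ℝ) + 1)) ≤ 1 := by
  have hn : (0 : ℝ) < (n : ℝ) + 1 := by positivity
  refine g.lift_spec.1.sub_le_one ?_
  rw [← sub_le_iff_le_add', ← sub_div, div_le_one hn]
  push_cast
  linarith [(Nat.cast_nonneg n : (0 : ℝ) ≤ n)]

open Classical in
/-- The Riemann sums for the logarithm of `Y⁰_h(g)` in terms of the circle map `g`. -/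
theorem IsC2Diffeo.logFactorSum_eq (hh : h.IsC2Diffeo) :
    h.logFactorSum g n =
      if ∀ i ∈ Finset.range (n + 1),
          g (((i : ℝ) / ((n : ℝ) + 1) : ℝ) : UnitAddCircle) = g ((0 : ℝ) : UnitAddCircle) then
        Real.log (h.derivative (g ((0 : ℝ) : UnitAddCircle)))
      else ∑ i ∈ Finset.range (n + 1),
        if g (((i : ℝ) / ((n : ℝ) + 1) : ℝ) : UnitAddCircle) =
            g (((i + 1 : ℕ) : ℝ) / ((n : ℝ) + 1) : ℝ) then 0
        else Real.log (h.gapFactor (g (((i : ℝ) / ((n : ℝ) + 1) : ℝ) : UnitAddCircle),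
          g ((((i + 1 : ℕ) : ℝ) / ((n : ℝ) + 1) : ℝ) : UnitAddCircle))) := by
  have hlast := g.lift_grid_last n
  have hle := fun i => g.lift_grid_sub_le_one n i
  have hmono := fun i j (hij : i ≤ j) => g.lift_grid_le n hij
  have hcoe : ∀ i : ℕ, g (((i : ℝ) / ((n : ℝ) + 1) : ℝ) : UnitAddCircle) =
    g.lift ((i : ℝ) / ((n : ℝ) + 1)) := fun i => (g.coe_lift _).symm
  have h00 : g ((0 : ℝ) : UnitAddCircle) = g.lift (((0 : ℕ) : ℝ) / ((n : ℝ) + 1)) := by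
    rw [g.coe_lift]; simp
  have hsumeq : h.logFactorSum g n = ∑ i ∈ Finset.range (n + 1),
      h.logFactor (g.lift ((i : ℝ) / ((n : ℝ) + 1)))
        (g.lift (((i + 1 : ℕ) : ℝ) / ((n : ℝ) + 1))) := by
    unfold logFactorSum; push_cast; rfl
  have hsub := Finset.sum_range_sub (fun i : ℕ => g.lift ((i : ℝ) / ((n : ℝ) + 1))) (n + 1)
  simp only [hcoe, h00, UnitAddCircle.coe_eq_coe_iff, log_derivative_coe, hsumeq]
  generalize hw : (fun i : ℕ => g.lift ((i : ℝ) / ((n : ℝ) + 1))) = w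
  have hw' : ∀ i : ℕ, g.lift ((i : ℝ) / ((n : ℝ) + 1)) = w i := fun i => congrFun hw i
  simp only [hw'] at *
  split_ifs with hc
  -- All grid values coincide on the circle: every increment of the lift is 0 or 1, and they add up
  -- to 1. So exactly one step is a full turn; the position of that step depends on the lift, its
  -- contribution does not.
  · have hterm : ∀ i ∈ Finset.range (n + 1), h.logFactor (w i) (w (i + 1)) =
        h.logDeriv (w 0) * (w (i + 1) - w i) := fun i hi => by
      obtain ⟨a, ha⟩ := hc i hi
      have hb : ∃ b : ℤ, w (i + 1) = w 0 + b := by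
        rcases (Nat.lt_succ_iff.1 (Finset.mem_range.1 hi)).eq_or_lt with rfl | h1
        · exact ⟨1, by rw [hlast, Int.cast_one]⟩
        · obtain ⟨b, hb⟩ := hc (i + 1) (Finset.mem_range.2 (by omega))
          exact ⟨-b, by rw [hb]; push_cast; ring⟩
      obtain ⟨b, hb⟩ := hb
      have h1 : h.logDeriv (w i) = h.logDeriv (w 0) := by
        rw [ha, logDeriv_add_int]
      have h2 := hle i
      have h3 := hmono i (i + 1) (Nat.le_succ i)
      have h4 : w (i + 1) = w i + ((a + b : ℤ) : ℝ) := by rw [hb, ha]; push_cast; ring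
      rw [h4] at h2 h3
      have h5 : a + b ≤ 1 := by
        have : ((a + b : ℤ) : ℝ) ≤ 1 := by linarith
        exact_mod_cast this
      have h6 : 0 ≤ a + b := by
        have : (0 : ℝ) ≤ ((a + b : ℤ) : ℝ) := by linarith
        exact_mod_cast this
      rw [h4, ← h1]
      rcases (show a + b = 0 ∨ a + b = 1 by omega) with h7 | h7
      · rw [h7]; simp [logFactor_self]
      · rw [h7]; simp [logFactor_add_one]
    rw [Finset.sum_congr rfl hterm, ← Finset.mul_sum, hsub, hlast]
    ring
  · refine Finset.sum_congr rfl fun i hi => ?_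
    have hi' := Finset.mem_range.1 hi
    have h2 := hle i
    have h3 := hmono i (i + 1) (Nat.le_succ i)
    -- An increment of 1 in a single cell would exhaust the period and make all grid values
    -- coincide. Hence equal neighbours on the circle mean increment 0 here, even though `arcLength`
    -- assigns them length 1.
    have hne : w (i + 1) - w i ≠ 1 := fun he => hc fun j hj => by
      have hj' := Finset.mem_range.1 hj
      have e1 := hmono (i + 1) (n + 1) (by omega)
      have e2 := hmono 0 i (by omega)
      rcases le_or_gt j i with hji | hji
      · have e3 := hmono 0 j (by omega)
        have e4 := hmono j i hji
        exact ⟨0, by rw [Int.cast_zero]; linarith⟩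
      · have e3 := hmono (i + 1) j (by omega)
        have e4 := hmono j (n + 1) (by omega)
        exact ⟨-1, by push_cast; linarith⟩
    split_ifs with h4
    · obtain ⟨m, hm⟩ := h4
      have h5 : m < 1 := by
        have : (m : ℝ) < 1 := lt_of_le_of_ne (by linarith) fun h => hne (by linarith)
        exact_mod_cast this
      have h6 : 0 ≤ m := by
        have : (0 : ℝ) ≤ m := by linarith
        exact_mod_cast this
      have h7 : m = 0 := by omega
      rw [hm, h7, Int.cast_zero, add_zero, logFactor_self]
    · have h5 : w i < w (i + 1) := lt_of_le_of_ne h3 fun h => h4 ⟨0, by simp [h]⟩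
      rw [hh.log_gapFactor_coe h5 (by linarith)]

theorem IsC2Diffeo.measurable_logFactorSum (hh : h.IsC2Diffeo) :
    Measurable fun g => h.logFactorSum g n := by
  classical
  simp only [fun g => hh.logFactorSum_eq g n]
  have he := fun t : ℝ => measurable_eval (t : UnitAddCircle)
  refine Measurable.ite ?_ (h.measurable_derivative.comp (he 0)).log
    (Finset.measurable_sum _ fun i _ => Measurable.ite ?_ measurable_const ?_)
  · simp only [ofPred_forall]
    exact Finset.measurableSet_biInter _ fun i _ => measurableSet_eq_fun (he _) (he _)
  · exact measurableSet_eq_fun (he _) (he _)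
  · exact (h.measurable_gapFactor.comp ((he _).prodMk (he _))).log

end Grid

theorem measurable_densityX (β : ℝ) (h : CircleMonotoneMap) : Measurable (densityX β h) := by
  unfold densityX
  have h1 : Measurable fun p : CircleMonotoneMap × UnitAddCircle =>
      Real.log (h.derivative (p.1 p.2)) := (h.measurable_derivative.comp measurable_uncurry).log
  have h2 := (h1.stronglyMeasurable.integral_prod_right' (ν := (volume : Measure UnitAddCircle)))
  exact (h2.measurable.const_mul β).exp

/-- The index set of the product varies with `g`, so measurability is read off from the Riemann
sums, which involve only finitely many evaluations. -/
theorem IsC2Diffeo.measurable_densityY (hh : h.IsC2Diffeo) (β : ℝ) :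
    Measurable (densityY β h) := by
  refine (measurable_densityX β h).mul ?_
  exact measurable_of_tendsto_metrizable (fun n => (hh.measurable_logFactorSum n).exp)
    (tendsto_pi_nhds.2 hh.tendsto_exp_logFactorSum)

end CircleMonotoneMap

/-! ### Gaps of the image measure -/

theorem coe_mem_openArc_iff {x y z : ℝ} (h0 : x < y) (h1 : y ≤ x + 1) :
    (z : UnitAddCircle) ∈ openArc (x : UnitAddCircle) (y : UnitAddCircle) ↔
      ∃ n : ℤ, z + n ∈ Ioo x y := by
  simp only [openArc, mem_ofPred_eq, arcLength_coe h0 h1]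
  constructor
  · intro h2
    have h3 := add_arcLength (x : UnitAddCircle) (z : UnitAddCircle)
    rw [← AddCircle.coe_add, eq_comm, UnitAddCircle.coe_eq_coe_iff] at h3
    obtain ⟨n, hn⟩ := h3
    refine ⟨n, ?_⟩
    rw [← hn]
    exact ⟨by linarith [arcLength_pos (x : UnitAddCircle) z], by linarith⟩
  · rintro ⟨n, h2, h3⟩
    have h4 : (z : UnitAddCircle) = ((z + n : ℝ) : UnitAddCircle) :=
      UnitAddCircle.coe_eq_coe_iff.2 ⟨n, rfl⟩
    rw [h4, arcLength_coe h2 (by linarith)]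
    linarith

theorem measurableSet_openArc (x y : UnitAddCircle) : MeasurableSet (openArc x y) :=
  measurableSet_lt (measurable_const.arcLength measurable_id) measurable_const

/-- Every pair of points of the circle lifts to the endpoints of a segment of `ℝ`. -/
theorem exists_lift_arc (p : UnitAddCircle × UnitAddCircle) : ∃ x y : ℝ, x < y ∧ y ≤ x + 1 ∧
    p = ((x : UnitAddCircle), (y : UnitAddCircle)) := by
  obtain ⟨x, hx⟩ := UnitAddCircle.exists_coe p.1
  refine ⟨x, x + arcLength p.1 p.2, by linarith [arcLength_pos p.1 p.2],
    by linarith [arcLength_le_one p.1 p.2], Prod.ext hx.symm ?_⟩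
  rw [AddCircle.coe_add, hx, add_arcLength]

namespace IsMonotoneLift

variable {G : ℝ → ℝ}

/-- An interval avoided by a monotone lift is contained in one of its jumps. -/
theorem exists_jump (hG : IsMonotoneLift G) {x y : ℝ} (hxy : ∀ s, G s ∉ Ioo x y) :
    ∃ a, Function.leftLim G a ≤ x ∧ y ≤ G a := by
  have hne : {s | y ≤ G s}.Nonempty := by
    refine ⟨0 + (⌈y - G 0⌉ : ℤ), ?_⟩
    rw [mem_ofPred_eq, hG.map_add_int]
    linarith [Int.le_ceil (y - G 0)]
  have hbd : BddBelow {s | y ≤ G s} := by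
    refine ⟨0 + (⌊y - G 0⌋ - 1 : ℤ), fun s hs => ?_⟩
    by_contra! hc
    have h1 := hG.mono hc.le
    rw [hG.map_add_int] at h1
    push_cast at h1
    have h2 : y ≤ G s := hs
    linarith [Int.floor_le (y - G 0)]
  -- The jump occurs where `G` first reaches `y`: before that point `G < y`, hence `G ≤ x` as the
  -- interval is avoided.
  refine ⟨sInf {s | y ≤ G s}, ?_, ?_⟩
  · refine le_of_tendsto (hG.mono.tendsto_leftLim _) ?_
    filter_upwards [self_mem_nhdsWithin] with s hs
    have h1 : s ∉ {s | y ≤ G s} := notMem_of_lt_csInf hs hbd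
    by_contra! hc
    exact hxy s ⟨hc, not_le.1 h1⟩
  · refine ge_of_tendsto ((hG.rightCont _).tendsto.mono_left
      (nhdsWithin_mono _ Ioi_subset_Ici_self)) ?_
    filter_upwards [self_mem_nhdsWithin] with s hs
    obtain ⟨t, ht, hts⟩ := exists_lt_of_csInf_lt hne hs
    exact le_trans ht (hG.mono hts.le)

theorem notMem_jump (hG : IsMonotoneLift G) (a s : ℝ) : G s ∉ Ioo (Function.leftLim G a) (G a) := by
  rintro ⟨h1, h2⟩
  rcases lt_or_ge s a with hs | hs
  · exact (hG.mono.le_leftLim hs).not_gt h1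
  · exact (hG.mono hs).not_gt h2

/-- Jumps at different locations are disjoint. -/
theorem jump_unique (hG : IsMonotoneLift G) {a b m : ℝ}
    (ha : m ∈ Ioo (Function.leftLim G a) (G a)) (hb : m ∈ Ioo (Function.leftLim G b) (G b)) :
    a = b := by
  rcases lt_trichotomy a b with h | h | h
  · exact absurd (hG.mono.le_leftLim h) (by linarith [ha.2, hb.1])
  · exact h
  · exact absurd (hG.mono.le_leftLim h) (by linarith [hb.2, ha.1])

end IsMonotoneLift

namespace CircleMonotoneMap

variable {h : CircleMonotoneMap}

theorem coe_chi (g : CircleMonotoneMap) :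
    (g.chi : Measure UnitAddCircle) = Measure.map g volume := rfl

/-- By right continuity, one value of the lift in `]x, y[` forces a whole interval of arguments with
values there, and such an interval has positive Lebesgue measure. -/
theorem chi_openArc_eq_zero_iff (g : CircleMonotoneMap) {x y : ℝ} (h0 : x < y) (h1 : y ≤ x + 1) :
    (g.chi : Measure UnitAddCircle) (openArc (x : UnitAddCircle) (y : UnitAddCircle)) = 0 ↔
      ∀ s, g.lift s ∉ Ioo x y := by
  rw [coe_chi, Measure.map_apply g.measurable_coe (measurableSet_openArc _ _)]
  constructor
  · intro hz s hs
    have h2 := g.lift_spec.1.rightCont s (Ioo_mem_nhds hs.1 hs.2)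
    obtain ⟨u, hu, hus⟩ := mem_nhdsGE_iff_exists_Ico_subset.1 h2
    have h3 : IsOpen (((↑) : ℝ → UnitAddCircle) '' Ioo s u) :=
      QuotientAddGroup.isOpenMap_coe _ isOpen_Ioo
    refine (h3.measure_pos volume ((nonempty_Ioo.2 hu).image _)).ne' (measure_mono_null ?_ hz)
    rintro _ ⟨t, ht, rfl⟩
    rw [mem_preimage, ← g.coe_lift, coe_mem_openArc_iff h0 h1]
    exact ⟨0, by simpa using hus (Ioo_subset_Ico_self ht)⟩
  · intro hs
    convert measure_empty (μ := (volume : Measure UnitAddCircle))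
    rw [eq_empty_iff_forall_notMem]
    intro p hp
    obtain ⟨s, rfl⟩ := UnitAddCircle.exists_coe p
    rw [mem_preimage, ← g.coe_lift, coe_mem_openArc_iff h0 h1] at hp
    obtain ⟨n, hn⟩ := hp
    rw [← g.lift_spec.1.map_add_int] at hn
    exact hs _ hn

/-- The arc skipped by `g` at a jump location. -/
noncomputable def jumpArc (g : CircleMonotoneMap) (a : ℝ) : UnitAddCircle × UnitAddCircle :=
  ((Function.leftLim g.lift a : ℝ), (g.lift a : ℝ))

theorem jumpArc_add_int (g : CircleMonotoneMap) (a : ℝ) (n : ℤ) :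
    g.jumpArc (a + n) = g.jumpArc a := by
  refine Prod.ext ?_ ?_ <;> refine (UnitAddCircle.coe_eq_coe_iff.2 ⟨n, ?_⟩).symm
  · exact g.lift_spec.1.leftLim_add_int a n
  · exact g.lift_spec.1.map_add_int a n

theorem lift_le_leftLim_add_one (g : CircleMonotoneMap) (a : ℝ) :
    g.lift a ≤ Function.leftLim g.lift a + 1 := by
  linarith [g.lift_spec.1.sub_leftLim_le_one a]

/-- A null arc containing the jump arc is avoided by the lift, hence lies inside some jump at `b`.
Since jumps are disjoint, `b` is an integer translate of `a`, and the two arcs coincide. -/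
theorem jumpArc_mem_gaps (g : CircleMonotoneMap) {a : ℝ}
    (ha : Function.leftLim g.lift a < g.lift a) : g.jumpArc a ∈ gaps g.chi := by
  have hG := g.lift_spec.1
  have hle := g.lift_le_leftLim_add_one a
  refine ⟨(g.chi_openArc_eq_zero_iff ha hle).2 (hG.notMem_jump a), fun J hJ hJ0 => ?_⟩
  obtain ⟨x, y, h0, h1, rfl⟩ := exists_lift_arc J
  obtain ⟨b, hb1, hb2⟩ := hG.exists_jump ((g.chi_openArc_eq_zero_iff h0 h1).1 hJ0)
  -- A priori the integer translating `z` into `]x, y[` depends on `z`. Uniqueness of jumps pins it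
  -- down by `b = a + n`, so the whole interval is moved by one translation.
  have hsub : ∀ z ∈ Ioo (Function.leftLim g.lift a) (g.lift a), ∃ n : ℤ, b = a + n ∧
      z + n ∈ Ioo x y := fun z hz => by
    have h2 : (z : UnitAddCircle) ∈ openArc (x : UnitAddCircle) (y : UnitAddCircle) :=
      hJ ((coe_mem_openArc_iff ha hle).2 ⟨0, by simpa using hz⟩)
    obtain ⟨n, hn⟩ := (coe_mem_openArc_iff h0 h1).1 h2
    refine ⟨n, ?_, hn⟩
    refine hG.jump_unique (m := z + n) ⟨by linarith [hn.1], by linarith [hn.2]⟩ ?_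
    rw [hG.leftLim_add_int, hG.map_add_int]
    exact ⟨by linarith [hz.1], by linarith [hz.2]⟩
  obtain ⟨n, hn, -⟩ := hsub ((Function.leftLim g.lift a + g.lift a) / 2)
    ⟨by linarith, by linarith⟩
  have hsub' : Ioo (Function.leftLim g.lift b) (g.lift b) ⊆ Ioo x y := fun z hz => by
    rw [hn, hG.leftLim_add_int, hG.map_add_int] at hz
    obtain ⟨m, hm, hmz⟩ := hsub (z - n) ⟨by linarith [hz.1], by linarith [hz.2]⟩
    have : (n : ℝ) = m := by linarith
    rwa [← this, sub_add_cancel] at hmz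
  have hb : Function.leftLim g.lift b < g.lift b := by linarith
  rw [Ioo_subset_Ioo_iff hb] at hsub'
  rw [← g.jumpArc_add_int a n, ← hn, jumpArc, le_antisymm hsub'.1 hb1, le_antisymm hb2 hsub'.2]

theorem exists_jumpArc_eq (g : CircleMonotoneMap) {I : UnitAddCircle × UnitAddCircle}
    (hI : I ∈ gaps g.chi) : ∃ a ∈ g.jumps, g.jumpArc a = I := by
  have hG := g.lift_spec.1
  obtain ⟨x, y, h0, h1, rfl⟩ := exists_lift_arc I
  obtain ⟨b, hb1, hb2⟩ := hG.exists_jump ((g.chi_openArc_eq_zero_iff h0 h1).1 hI.1)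
  have hb : Function.leftLim g.lift b < g.lift b := by linarith
  have hble := g.lift_le_leftLim_add_one b
  have h2 : g.jumpArc b = ((x : UnitAddCircle), (y : UnitAddCircle)) := by
    refine hI.2 _ (fun p hp => ?_) (g.jumpArc_mem_gaps hb).1
    obtain ⟨z, rfl⟩ := UnitAddCircle.exists_coe p
    obtain ⟨n, hn⟩ := (coe_mem_openArc_iff h0 h1).1 hp
    exact (coe_mem_openArc_iff hb hble).2 ⟨n, by linarith [hn.1], by linarith [hn.2]⟩
  have h3 : Int.fract b = b + ((-⌊b⌋ : ℤ) : ℝ) := by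
    rw [Int.fract]; push_cast; ring
  refine ⟨Int.fract b, ⟨⟨Int.fract_nonneg b, Int.fract_lt_one b⟩, ?_⟩, ?_⟩
  · rw [h3, hG.leftLim_add_int, hG.map_add_int]
    intro h4
    linarith
  · rw [h3, jumpArc_add_int, h2]

/-- Jump lengths lie in `(0, 1]`, so lifted endpoints of equal arcs differ by the same integer `n`
on both sides. Then `b = a + n` by disjointness of jumps, and `n = 0` because both points are in
`[0, 1)`. -/
theorem jumpArc_injOn (g : CircleMonotoneMap) : InjOn g.jumpArc g.jumps := by
  intro a ha b hb hab
  have hG := g.lift_spec.1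
  have ha' := leftLim_lift_lt ha
  have hb' := leftLim_lift_lt hb
  have ha1 := g.lift_le_leftLim_add_one a
  have hb1 := g.lift_le_leftLim_add_one b
  obtain ⟨k, hk⟩ := UnitAddCircle.coe_eq_coe_iff.1 (congrArg Prod.fst hab)
  obtain ⟨n, hn⟩ := UnitAddCircle.coe_eq_coe_iff.1 (congrArg Prod.snd hab)
  have h1 : (n : ℝ) < k + 1 := by linarith
  have h2 : (k : ℝ) < n + 1 := by linarith
  have h3 : n = k := by
    have h1 : n < k + 1 := by exact_mod_cast h1
    have h2 : k < n + 1 := by exact_mod_cast h2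
    omega
  subst h3
  have h4 : b = a + n := by
    refine hG.jump_unique (m := (Function.leftLim g.lift b + g.lift b) / 2)
      ⟨by linarith, by linarith⟩ ?_
    rw [hG.leftLim_add_int, hG.map_add_int]
    exact ⟨by linarith, by linarith⟩
  obtain ⟨⟨ha2, ha3⟩, -⟩ := ha
  obtain ⟨⟨hb2, hb3⟩, -⟩ := hb
  have h5 : (n : ℝ) < 1 := by linarith
  have h6 : (-1 : ℝ) < n := by linarith
  have h7 : n = 0 := by
    have h5 : n < 1 := by exact_mod_cast h5
    have h6 : -1 < n := by exact_mod_cast h6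
    omega
  rw [h4, h7, Int.cast_zero, add_zero]

/-- The jumps of `g` correspond to the gaps of `g_* Leb`. -/
noncomputable def jumpsEquivGaps (g : CircleMonotoneMap) : g.jumps ≃ gaps g.chi :=
  Equiv.ofBijective (fun a => ⟨g.jumpArc a, g.jumpArc_mem_gaps (leftLim_lift_lt a.2)⟩)
    ⟨fun a b hab => Subtype.ext (g.jumpArc_injOn a.2 b.2 (congrArg Subtype.val hab)),
      fun I => by
        obtain ⟨a, ha, h1⟩ := g.exists_jumpArc_eq I.2
        exact ⟨⟨a, ha⟩, Subtype.ext h1⟩⟩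

theorem IsC2Diffeo.gapFactor_jumpsEquivGaps (hh : h.IsC2Diffeo) (g : CircleMonotoneMap)
    (a : g.jumps) : h.gapFactor (g.jumpsEquivGaps a) = h.jumpFactor g a := by
  change h.gapFactor (g.jumpArc a) = _
  rw [jumpArc, hh.gapFactor_coe (leftLim_lift_lt a.2) (g.lift_le_leftLim_add_one a)]
  simp only [jumpFactor, derivative_coe]

theorem IsC2Diffeo.multipliable_gapFactor_chi (hh : h.IsC2Diffeo) (g : CircleMonotoneMap) :
    Multipliable fun I : gaps g.chi => h.gapFactor I := by
  rw [← g.jumpsEquivGaps.multipliable_iff]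
  exact (hh.multipliable_jumpFactor g).congr fun a => (hh.gapFactor_jumpsEquivGaps g a).symm

theorem IsC2Diffeo.densityY_eq (hh : h.IsC2Diffeo) (β : ℝ) (g : CircleMonotoneMap) :
    densityY β h g = entropicDensity β h g.chi := by
  rw [densityY, entropicDensity, densityX, densityY0, coe_chi,
    integral_map g.measurable_coe.aemeasurable
      (h.measurable_derivative.log.aestronglyMeasurable),
    ← g.jumpsEquivGaps.tprod_eq]
  simp only [hh.gapFactor_jumpsEquivGaps g]

end CircleMonotoneMap

/-! ### Quantile maps: the map `χ` has a measurable right inverse -/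

namespace UnitAddCircle

/-- The representative in `[0, 1)` of a point of the circle. -/
noncomputable def rep (p : UnitAddCircle) : ℝ := (AddCircle.equivIco (1 : ℝ) 0 p : ℝ)

theorem coe_rep (p : UnitAddCircle) : (rep p : UnitAddCircle) = p := AddCircle.coe_equivIco

theorem rep_nonneg (p : UnitAddCircle) : 0 ≤ rep p := (AddCircle.equivIco (1 : ℝ) 0 p).2.1

theorem rep_lt_one (p : UnitAddCircle) : rep p < 1 := by
  simpa [rep] using (AddCircle.equivIco (1 : ℝ) 0 p).2.2

theorem rep_coe {x : ℝ} (h0 : 0 ≤ x) (h1 : x < 1) : rep (x : UnitAddCircle) = x := by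
  unfold rep
  rw [AddCircle.equivIco_coe_eq (p := (1 : ℝ)) (a := 0) ⟨h0, by simpa using h1⟩]

theorem measurable_rep : Measurable rep :=
  measurable_subtype_coe.comp (AddCircle.measurableEquivIco (1 : ℝ) 0).measurable

end UnitAddCircle

section Quantile

open UnitAddCircle ProbabilityTheory

namespace CircleMonotoneMap

variable (μ : ProbabilityMeasure UnitAddCircle)

/-- The distribution function on `[0, 1)` of a probability measure on the circle. -/
noncomputable def circleCDF : StieltjesFunction ℝ :=
  cdf (Measure.map rep (μ : Measure UnitAddCircle))

instance isProbabilityMeasure_map_rep :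
    IsProbabilityMeasure (Measure.map rep (μ : Measure UnitAddCircle)) :=
  Measure.isProbabilityMeasure_map measurable_rep.aemeasurable

theorem circleCDF_eq (x : ℝ) :
    circleCDF μ x = (μ : Measure UnitAddCircle).real (rep ⁻¹' Iic x) := by
  rw [circleCDF, cdf_eq_real, Measure.real, Measure.map_apply measurable_rep measurableSet_Iic,
    Measure.real]

theorem circleCDF_nonneg (x : ℝ) : 0 ≤ circleCDF μ x := cdf_nonneg _ x

theorem circleCDF_le_one (x : ℝ) : circleCDF μ x ≤ 1 := cdf_le_one _ x

/-- Representatives lie in `[0, 1)`, so there is no atom at 1 and the full mass is already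
approached from the left. This keeps the quantiles of levels `s < 1` strictly below 1. -/
theorem leftLim_circleCDF_one : Function.leftLim (circleCDF μ) 1 = 1 := by
  have h1 : (circleCDF μ).measure {1} = 0 := by
    rw [circleCDF, measure_cdf, Measure.map_apply measurable_rep (measurableSet_singleton 1)]
    convert measure_empty (μ := (μ : Measure UnitAddCircle))
    rw [eq_empty_iff_forall_notMem]
    intro p hp
    exact (rep_lt_one p).ne hp
  have h2 : circleCDF μ 1 = 1 := by
    rw [circleCDF_eq]
    convert probReal_univ (μ := (μ : Measure UnitAddCircle))
    rw [eq_univ_iff_forall]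
    exact fun p => (rep_lt_one p).le
  rw [StieltjesFunction.measure_singleton, ENNReal.ofReal_eq_zero, h2] at h1
  refine le_antisymm ?_ (by linarith)
  exact ((circleCDF μ).mono.leftLim_le le_rfl).trans_eq h2

/-- The distribution function of the periodic extension to `ℝ` of a measure on the circle. -/
noncomputable def periodicCDF (x : ℝ) : ℝ := ⌊x⌋ + circleCDF μ (Int.fract x)

theorem periodicCDF_add_one (x : ℝ) : periodicCDF μ (x + 1) = periodicCDF μ x + 1 := by
  simp only [periodicCDF, Int.floor_add_one, Int.fract_add_one]
  push_cast; ring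

theorem periodicCDF_of_mem {x : ℝ} (h0 : 0 ≤ x) (h1 : x < 1) :
    periodicCDF μ x = circleCDF μ x := by
  rw [periodicCDF, Int.floor_eq_zero_iff.2 ⟨h0, h1⟩, Int.fract_eq_self.2 ⟨h0, h1⟩]
  simp

theorem periodicCDF_le (x : ℝ) : periodicCDF μ x ≤ ⌊x⌋ + 1 :=
  add_le_add_right (circleCDF_le_one μ _) _

theorem le_periodicCDF (x : ℝ) : (⌊x⌋ : ℝ) ≤ periodicCDF μ x :=
  le_add_of_nonneg_right (circleCDF_nonneg μ _)

theorem monotone_periodicCDF : Monotone (periodicCDF μ) := by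
  intro x y hxy
  rcases (Int.floor_mono hxy).eq_or_lt with h | h
  · rw [periodicCDF, periodicCDF, h]
    refine add_le_add_right ((circleCDF μ).mono ?_) _
    rw [Int.fract, Int.fract, h]; linarith
  · have h1 : ((⌊x⌋ : ℝ) + 1) ≤ ⌊y⌋ := by exact_mod_cast h
    exact (periodicCDF_le μ x).trans (h1.trans (le_periodicCDF μ y))

/-- The right continuous inverse of the distribution function. -/
noncomputable def quantileLift (s : ℝ) : ℝ := sInf {x | s < periodicCDF μ x}

theorem quantileLift_set_nonempty (s : ℝ) : {x | s < periodicCDF μ x}.Nonempty := by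
  refine ⟨s + 1, ?_⟩
  rw [mem_ofPred_eq]
  refine lt_of_lt_of_le ?_ (le_periodicCDF μ _)
  rw [Int.floor_add_one]; push_cast
  exact Int.lt_floor_add_one s

theorem quantileLift_set_bddBelow (s : ℝ) : BddBelow {x | s < periodicCDF μ x} :=
  ⟨s - 1, fun x hx => by
    have h1 := lt_of_lt_of_le (show s < periodicCDF μ x from hx) (periodicCDF_le μ x)
    linarith [Int.floor_le x]⟩

theorem quantileLift_lt_iff {s y : ℝ} :
    quantileLift μ s < y ↔ ∃ x, s < periodicCDF μ x ∧ x < y :=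
  csInf_lt_iff (quantileLift_set_bddBelow μ s) (quantileLift_set_nonempty μ s)

theorem quantileLift_le {s x : ℝ} (h : s < periodicCDF μ x) : quantileLift μ s ≤ x :=
  csInf_le (quantileLift_set_bddBelow μ s) h

theorem lt_periodicCDF {s y : ℝ} (h : quantileLift μ s < y) : s < periodicCDF μ y := by
  obtain ⟨x, h1, h2⟩ := (quantileLift_lt_iff μ).1 h
  exact h1.trans_le (monotone_periodicCDF μ h2.le)

/-- Right continuity comes from the strict inequality in the definition: a point `x` with `s <
periodicCDF μ x` still serves for all levels slightly above `s`. -/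
theorem isMonotoneLift_quantileLift : IsMonotoneLift (quantileLift μ) := by
  have hmono : Monotone (quantileLift μ) := fun s t hst =>
    csInf_le_csInf (quantileLift_set_bddBelow μ s) (quantileLift_set_nonempty μ t)
      fun x hx => lt_of_le_of_lt hst hx
  refine ⟨hmono, fun s => ?_, fun s => ?_⟩
  · refine tendsto_order.2 ⟨fun a ha => ?_, fun b hb => ?_⟩
    · filter_upwards [self_mem_nhdsWithin] with t ht
      exact ha.trans_le (hmono ht)
    · obtain ⟨x, h1, h2⟩ := (quantileLift_lt_iff μ).1 hb
      filter_upwards [nhdsWithin_le_nhds (Iio_mem_nhds h1)] with t ht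
      exact (quantileLift_le μ ht).trans_lt h2
  · refine eq_of_forall_gt_iff fun y => ?_
    rw [← lt_sub_iff_add_lt, quantileLift_lt_iff, quantileLift_lt_iff]
    constructor
    · rintro ⟨x, h1, h2⟩
      have h3 := periodicCDF_add_one μ (x - 1)
      rw [sub_add_cancel] at h3
      exact ⟨x - 1, by linarith, by linarith⟩
    · rintro ⟨x, h1, h2⟩
      exact ⟨x + 1, by rw [periodicCDF_add_one]; linarith, by linarith⟩

/-- The quantile map of a probability measure on the circle. -/
noncomputable def quantile : CircleMonotoneMap :=
  ofLift (quantileLift μ) (isMonotoneLift_quantileLift μ)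

theorem quantile_coe (s : ℝ) : quantile μ (s : UnitAddCircle) = quantileLift μ s :=
  ofLift_coe (isMonotoneLift_quantileLift μ) s

theorem quantileLift_mem {s : ℝ} (h0 : 0 ≤ s) (h1 : s < 1) : quantileLift μ s ∈ Ico (0 : ℝ) 1 := by
  constructor
  · by_contra! hc
    obtain ⟨x, h2, h3⟩ := (quantileLift_lt_iff μ).1 hc
    have h4 : (⌊x⌋ : ℝ) + 1 ≤ 0 := by
      have : ⌊x⌋ < 0 := Int.floor_lt.2 (by simpa using h3)
      exact_mod_cast this
    linarith [periodicCDF_le μ x]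
  · have h2 := (circleCDF μ).mono.tendsto_leftLim 1
    rw [leftLim_circleCDF_one] at h2
    have h3 : ∀ᶠ x in 𝓝[<] (1 : ℝ), s < circleCDF μ x := h2.eventually (lt_mem_nhds h1)
    have h4 : ∀ᶠ x in 𝓝[<] (1 : ℝ), (0 : ℝ) < x := nhdsWithin_le_nhds (lt_mem_nhds one_pos)
    obtain ⟨x, h5, h6, h7⟩ := (h3.and (h4.and self_mem_nhdsWithin)).exists
    rw [← periodicCDF_of_mem μ h6.le h7] at h5
    exact (quantileLift_le μ h5).trans_lt h7

theorem le_circleCDF_of_quantileLift_le {s a : ℝ} (h0 : 0 ≤ a) (h1 : a < 1)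
    (h : quantileLift μ s ≤ a) : s ≤ circleCDF μ a := by
  refine ge_of_tendsto (((circleCDF μ).right_continuous a).tendsto.mono_left
    (nhdsWithin_mono _ Ioi_subset_Ici_self)) ?_
  filter_upwards [self_mem_nhdsWithin, nhdsWithin_le_nhds (Iio_mem_nhds h1)] with y hy hy1
  rw [← periodicCDF_of_mem μ (h0.trans (le_of_lt hy)) hy1]
  exact (lt_periodicCDF μ (h.trans_lt hy)).le

/-- Within `]0, 1[`, the levels whose quantile is at most `a` lie between `]0, F(a)[` and `[0,
F(a)]`, where `F` is `circleCDF μ`. Both have the same length. -/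
theorem volume_rep_quantile_le {a : ℝ} (h0 : 0 ≤ a) (h1 : a < 1) :
    (volume : Measure UnitAddCircle) {p | rep (quantile μ p) ≤ a} =
      ENNReal.ofReal (circleCDF μ a) := by
  have hms : MeasurableSet {p : UnitAddCircle | rep (quantile μ p) ≤ a} :=
    measurableSet_le (measurable_rep.comp (quantile μ).measurable_coe) measurable_const
  have hrep : ∀ {s : ℝ}, 0 ≤ s → s < 1 → rep (quantile μ (s : UnitAddCircle)) = quantileLift μ s :=
    fun h2 h3 => by
      have h4 := quantileLift_mem μ h2 h3
      rw [quantile_coe, rep_coe h4.1 h4.2]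
  have hpre := hms.preimage (AddCircle.measurable_mk' (a := (1 : ℝ)))
  -- The endpoint `s = 1` is dropped as a null set: the quantile lift has left `[0, 1)` there, so
  -- `rep` no longer returns it.
  rw [← (UnitAddCircle.measurePreserving_mk 0).measure_preimage hms.nullMeasurableSet, zero_add,
    ← Measure.restrict_congr_set Ioo_ae_eq_Ioc, Measure.restrict_apply hpre]
  refine le_antisymm ?_ ?_
  · refine (measure_mono (t := Icc 0 (circleCDF μ a)) fun s hs => ?_).trans
      (by rw [Real.volume_Icc, sub_zero])
    obtain ⟨hs1, hs2, hs3⟩ := hs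
    have hs1' : rep (quantile μ (s : UnitAddCircle)) ≤ a := hs1
    rw [hrep hs2.le hs3] at hs1'
    exact ⟨hs2.le, le_circleCDF_of_quantileLift_le μ h0 h1 hs1'⟩
  · refine le_trans (by rw [Real.volume_Ioo, sub_zero])
      (measure_mono (s := Ioo 0 (circleCDF μ a)) fun s hs => ?_)
    have hs1 : s < 1 := hs.2.trans_le (circleCDF_le_one μ a)
    refine ⟨?_, hs.1, hs1⟩
    change rep (quantile μ (s : UnitAddCircle)) ≤ a
    rw [hrep hs.1.le hs1]
    refine quantileLift_le μ ?_
    rw [periodicCDF_of_mem μ h0 h1]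
    exact hs.2

/-- Both measures are carried to `[0, 1)` by `rep`, from which they can be recovered, and compared
there through their distribution functions. -/
theorem chi_quantile : (quantile μ).chi = μ := by
  apply Subtype.ext
  change ((quantile μ).chi : Measure UnitAddCircle) = (μ : Measure UnitAddCircle)
  have hback : ∀ ν : Measure UnitAddCircle,
      Measure.map ((↑) : ℝ → UnitAddCircle) (Measure.map rep ν) = ν := fun ν => by
    rw [Measure.map_map AddCircle.measurable_mk' measurable_rep]
    convert Measure.map_id
    exact funext coe_rep
  rw [← hback (μ : Measure UnitAddCircle), ← hback ((quantile μ).chi : Measure UnitAddCircle)]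
  congr 1
  refine Measure.ext_of_Iic _ _ fun a => ?_
  rw [Measure.map_apply measurable_rep measurableSet_Iic,
    Measure.map_apply measurable_rep measurableSet_Iic]
  rcases lt_or_ge a 0 with h0 | h0
  · have : rep ⁻¹' Iic a = ∅ :=
      eq_empty_iff_forall_notMem.2 fun p hp => ((rep_nonneg p).trans hp).not_gt h0
    rw [this, measure_empty, measure_empty]
  rcases le_or_gt 1 a with h1 | h1
  · have : rep ⁻¹' Iic a = univ := eq_univ_iff_forall.2 fun p => (rep_lt_one p).le.trans h1
    rw [this, measure_univ, measure_univ]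
  · rw [coe_chi, Measure.map_apply (quantile μ).measurable_coe (measurable_rep measurableSet_Iic)]
    refine (volume_rep_quantile_le μ h0 h1).trans ?_
    rw [circleCDF_eq, Measure.real, ENNReal.ofReal_toReal (measure_ne_top _ _)]

/-- Monotonicity of the distribution function allows the witness for `quantileLift μ s < y` to be
taken rational. -/
theorem measurable_quantileLift (s : ℝ) :
    Measurable fun μ : ProbabilityMeasure UnitAddCircle => quantileLift μ s := by
  refine measurable_of_Iio fun y => ?_
  have h1 : (fun μ : ProbabilityMeasure UnitAddCircle => quantileLift μ s) ⁻¹' Iio y =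
      ⋃ q : ℚ, ⋃ _ : (q : ℝ) < y, {μ | s < periodicCDF μ q} := by
    ext μ
    simp only [mem_preimage, mem_Iio, quantileLift_lt_iff, mem_iUnion, mem_ofPred_eq,
      exists_prop]
    constructor
    · rintro ⟨x, h2, h3⟩
      obtain ⟨q, h4, h5⟩ := exists_rat_btwn h3
      exact ⟨q, h5, h2.trans_le (monotone_periodicCDF μ h4.le)⟩
    · rintro ⟨q, h2, h3⟩
      exact ⟨q, h3, h2⟩
  rw [h1]
  refine MeasurableSet.iUnion fun q => MeasurableSet.iUnion fun _ =>
    measurableSet_lt measurable_const ?_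
  simp only [periodicCDF, circleCDF_eq, Measure.real]
  exact measurable_const.add (((Measure.measurable_coe
    (measurable_rep measurableSet_Iic)).comp measurable_subtype_coe).ennreal_toReal)

theorem measurable_quantile : Measurable quantile := by
  refine Measurable.of_comap_le ?_
  rw [instMeasurableSpace, MeasurableSpace.comap_comp, ← measurable_iff_comap_le]
  refine measurable_pi_lambda _ fun t => ?_
  obtain ⟨s, rfl⟩ := UnitAddCircle.exists_coe t
  simp only [Function.comp_apply, quantile_coe]
  exact AddCircle.measurable_mk'.comp (measurable_quantileLift s)

variable {h : CircleMonotoneMap}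

/-- Every `μ` is `chi` of its quantile map, so the convergence proved for the jumps of monotone maps
covers all probability measures. -/
theorem IsC2Diffeo.multipliable_gapFactor (hh : h.IsC2Diffeo) :
    Multipliable fun I : gaps μ => h.gapFactor I := by
  have h1 := hh.multipliable_gapFactor_chi (quantile μ)
  rwa [chi_quantile] at h1

theorem IsC2Diffeo.measurable_entropicDensity (hh : h.IsC2Diffeo) (β : ℝ) :
    Measurable (entropicDensity β h) := by
  have h1 : entropicDensity β h = fun μ => densityY β h (quantile μ) := funext fun μ => by
    rw [hh.densityY_eq, chi_quantile]
  rw [h1]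
  exact (hh.measurable_densityY β).comp measurable_quantile

end CircleMonotoneMap

end Quantile

/-! ### Change of variables for the finite-dimensional distributions -/

section Families

variable {n : ℕ}

theorem measurable_arcLength_pi (i j : Fin (n + 1)) :
    Measurable fun x : Fin (n + 1) → UnitAddCircle => arcLength (x i) (x j) :=
  (measurable_pi_apply i).arcLength (measurable_pi_apply j)

theorem measurableSet_isOrderedFamily :
    MeasurableSet {x : Fin (n + 1) → UnitAddCircle | IsOrderedFamily x} :=
  measurableSet_eq_fun (Finset.measurable_sum _ fun i _ => measurable_arcLength_pi i (i + 1))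
    measurable_const

theorem sum_cyclic_sub (z : Fin (n + 1) → ℝ) : ∑ i, (z (i + 1) - z i) = 0 := by
  rw [Finset.sum_sub_distrib, sub_eq_zero]
  exact Equiv.sum_comp (Equiv.addRight (1 : Fin (n + 1))) z

end Families

namespace CircleMonotoneMap

variable {h k : CircleMonotoneMap}

theorem IsC2Diffeo.map_withDensity_derivative (hh : h.IsC2Diffeo) :
    Measure.map h ((volume : Measure UnitAddCircle).withDensity
      fun x => ENNReal.ofReal (h.derivative x)) = volume := by
  have hd : Measurable fun x => ENNReal.ofReal (h.derivative x) :=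
    h.measurable_derivative.ennreal_ofReal
  -- The image of a fundamental domain is again one, starting at `h.lift 0`; circle integrals may be
  -- computed over either.
  have himage : h.lift '' Ioc 0 1 = Ioc (h.lift 0) (h.lift 0 + 1) := by
    obtain ⟨K, -, -, hK⟩ := hh.exists_inverse
    have h1 := h.lift_spec.1.map_add_one 0
    rw [zero_add] at h1
    rw [← h1]
    ext y
    constructor
    · rintro ⟨x, hx, rfl⟩
      exact ⟨hh.strictMono hx.1, hh.strictMono.monotone hx.2⟩
    · rintro ⟨h2, h3⟩
      rw [← hK y, hh.strictMono.lt_iff_lt] at h2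
      rw [← hK y, hh.strictMono.le_iff_le] at h3
      exact ⟨K y, ⟨h2, h3⟩, hK y⟩
  refine Measure.ext_of_lintegral _ fun f hf => ?_
  rw [lintegral_map hf h.measurable_coe]
  change ∫⁻ x, (f ∘ h) x ∂_ = _
  rw [lintegral_withDensity_eq_lintegral_mul _ hd (hf.comp h.measurable_coe),
    ← UnitAddCircle.lintegral_preimage 0, ← UnitAddCircle.lintegral_preimage (h.lift 0),
    ← himage, zero_add, lintegral_image_eq_lintegral_deriv_mul_of_monotoneOn measurableSet_Ioc
      (fun x _ => (hh.differentiable x).hasDerivAt.hasDerivWithinAt)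
      (h.lift_spec.1.mono.monotoneOn _)]
  simp only [Pi.mul_apply, derivative_coe, coe_lift]
  rfl

variable {n : ℕ}

theorem measurable_pi_map (h : CircleMonotoneMap) :
    Measurable fun (x : Fin n → UnitAddCircle) i => h (x i) :=
  measurable_pi_lambda _ fun i => h.measurable_coe.comp (measurable_pi_apply i)

theorem measurable_prod_derivative (h : CircleMonotoneMap) :
    Measurable fun x : Fin n → UnitAddCircle => ∏ i, ENNReal.ofReal (h.derivative (x i)) :=
  Finset.measurable_prod _ fun i _ =>
    (h.measurable_derivative.comp (measurable_pi_apply i)).ennreal_ofReal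

/-- It suffices to test boxes. There the integrand is a product of functions of single coordinates,
which are independent, so the one-dimensional change of variables applies factor by factor. -/
theorem IsC2Diffeo.map_pi_withDensity_derivative (hh : h.IsC2Diffeo) :
    Measure.map (fun (x : Fin n → UnitAddCircle) i => h (x i))
      ((volume : Measure (Fin n → UnitAddCircle)).withDensity
        fun x => ∏ i, ENNReal.ofReal (h.derivative (x i))) = volume := by
  have hvol : IsProbabilityMeasure (volume : Measure UnitAddCircle) :=
    ⟨UnitAddCircle.measure_univ⟩
  rw [volume_pi]
  symm
  refine Measure.pi_eq fun s hs => ?_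
  have hpre : (fun (x : Fin n → UnitAddCircle) i => h (x i)) ⁻¹' pi univ s =
      {x | ∀ i, x i ∈ h ⁻¹' s i} := by
    ext x; simp
  have hms : MeasurableSet {x : Fin n → UnitAddCircle | ∀ i, x i ∈ h ⁻¹' s i} := by
    rw [← hpre]
    exact h.measurable_pi_map (MeasurableSet.univ_pi hs)
  have hf : ∀ i, Measurable ((h ⁻¹' s i).indicator fun x => ENNReal.ofReal (h.derivative x)) :=
    fun i => h.measurable_derivative.ennreal_ofReal.indicator (h.measurable_coe (hs i))
  have hind := ProbabilityTheory.iIndepFun_pi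
    (μ := fun _ : Fin n => (volume : Measure UnitAddCircle)) fun i => (hf i).aemeasurable
  rw [Measure.map_apply h.measurable_pi_map (MeasurableSet.univ_pi hs), hpre,
    withDensity_apply _ hms, ← lintegral_indicator hms]
  have hprod : ({x : Fin n → UnitAddCircle | ∀ i, x i ∈ h ⁻¹' s i}.indicator
      fun x => ∏ i, ENNReal.ofReal (h.derivative (x i))) = fun x => ∏ i,
        (h ⁻¹' s i).indicator (fun x => ENNReal.ofReal (h.derivative x)) (x i) := by
    funext x
    by_cases hx : ∀ i, x i ∈ h ⁻¹' s i
    · refine (indicator_of_mem (s := {x : Fin n → UnitAddCircle | ∀ i, x i ∈ h ⁻¹' s i})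
        hx _).trans ?_
      exact Finset.prod_congr rfl fun i _ => 
        (indicator_of_mem (hx i) fun x => ENNReal.ofReal (h.derivative x)).symm
    · refine (indicator_of_notMem (s := {x : Fin n → UnitAddCircle | ∀ i, x i ∈ h ⁻¹' s i})
        hx _).trans ?_
      push Not at hx
      obtain ⟨i, hi⟩ := hx
      exact (Finset.prod_eq_zero (Finset.mem_univ i) (indicator_of_notMem hi _)).symm
  rw [hprod, ProbabilityTheory.lintegral_prod_eq_prod_lintegral_of_indepFun Finset.univ _ hind
    fun i => (hf i).comp (measurable_pi_apply i)]
  refine Finset.prod_congr rfl fun i _ => ?_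
  rw [(measurePreserving_eval (fun _ : Fin n => (volume : Measure UnitAddCircle)) i).lintegral_comp
    (hf i), lintegral_indicator (h.measurable_coe (hs i)),
    ← withDensity_apply _ (h.measurable_coe (hs i)), ← Measure.map_apply h.measurable_coe (hs i),
    hh.map_withDensity_derivative]

/-- A diffeomorphism of the circle preserves the winding number of a cyclic family. -/
theorem IsC2Diffeo.sum_arcLength_map (hh : h.IsC2Diffeo) (x : Fin (n + 1) → UnitAddCircle) :
    ∑ i, arcLength (h (x i)) (h (x (i + 1))) = ∑ i, arcLength (x i) (x (i + 1)) := by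
  choose X hX using fun i => UnitAddCircle.exists_coe (x i)
  -- The cyclic sum of arc lengths equals the sum of the integers `m i`, as the differences of lifts
  -- cancel. Since `h.lift` commutes with integer translations, the image family has the same
  -- integers.
  have hm : ∀ i, ∃ m : ℤ, X i + arcLength (x i) (x (i + 1)) = X (i + 1) + m := fun i => by
    rw [← UnitAddCircle.coe_eq_coe_iff, AddCircle.coe_add, hX, hX, add_arcLength]
  choose m hm using hm
  have h1 : ∀ i, arcLength (x i) (x (i + 1)) = X (i + 1) - X i + m i := fun i => by
    linarith [hm i]
  have h2 : ∀ i, arcLength (h (x i)) (h (x (i + 1))) =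
      h.lift (X (i + 1)) - h.lift (X i) + m i := fun i => by
    have h3 : x (i + 1) = ((X i + arcLength (x i) (x (i + 1)) : ℝ) : UnitAddCircle) := by
      rw [AddCircle.coe_add, hX, add_arcLength]
    have h4 : arcLength (h (x i)) (h (x (i + 1))) =
        arcLength (h (X i)) (h ((X i + arcLength (x i) (x (i + 1)) : ℝ) : UnitAddCircle)) := by
      rw [← h3, hX]
    rw [h4, hh.arcLength_map (by linarith [arcLength_pos (x i) (x (i + 1))])
      (by linarith [arcLength_le_one (x i) (x (i + 1))]), hm, h.lift_spec.1.map_add_int]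
    ring
  simp only [h2]
  rw [Finset.sum_congr rfl fun i _ => h1 i, Finset.sum_add_distrib, Finset.sum_add_distrib,
    sum_cyclic_sub X, sum_cyclic_sub fun i => h.lift (X i)]

theorem IsC2Diffeo.isOrderedFamily_map_iff (hh : h.IsC2Diffeo) (x : Fin (n + 1) → UnitAddCircle) :
    IsOrderedFamily (fun i => h (x i)) ↔ IsOrderedFamily x := by
  rw [IsOrderedFamily, IsOrderedFamily, hh.sum_arcLength_map]

/-- The density of the transformed finite-dimensional distribution. -/
noncomputable def marginalRatio (β : ℝ) (h : CircleMonotoneMap) (t x : Fin (n + 1) → UnitAddCircle) :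
    ℝ :=
  (∏ i, h.derivative (x i)) *
    ∏ i, (arcLength (h (x i)) (h (x (i + 1))) / arcLength (x i) (x (i + 1))) ^
      (β * arcLength (t i) (t (i + 1)) - 1)

theorem measurable_marginalRatio (β : ℝ) (h : CircleMonotoneMap)
    (t : Fin (n + 1) → UnitAddCircle) : Measurable (marginalRatio β h t) := by
  refine Measurable.mul (Finset.measurable_prod _ fun i _ =>
    h.measurable_derivative.comp (measurable_pi_apply i)) (Finset.measurable_prod _ fun i _ => ?_)
  exact (((measurable_arcLength_pi i (i + 1)).comp h.measurable_pi_map).div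
    (measurable_arcLength_pi i (i + 1))).pow_const _

/-- Substituting `y = h(x)` in the law of `y` gives the density `D(h(x)) * ∏ h'(x i)` for `x =
k(y)`; dividing by `D(x)` cancels the Gamma factors and leaves `marginalRatio`. Ordered families
correspond to ordered families. -/
theorem IsC2Diffeo.map_dirichletMarginal (hh : h.IsC2Diffeo) (hk : k.comp h = identity) (β : ℝ)
    (t : Fin (n + 1) → UnitAddCircle) :
    (dirichletMarginal β t).map (fun x i => k (x i)) =
      (dirichletMarginal β t).withDensity fun x => ENNReal.ofReal (marginalRatio β h t x) := by
  have hkh : ∀ p, k (h p) = p := fun p => congrFun (congrArg toFun hk) p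
  have hO := measurableSet_isOrderedFamily (n := n)
  have hR := (measurable_marginalRatio β h t).ennreal_ofReal
  unfold dirichletMarginal
  set D : (Fin (n + 1) → UnitAddCircle) → ℝ≥0∞ := fun x =>
    ENNReal.ofReal
      (Real.Gamma β / (∏ i, Real.Gamma (β * arcLength (t i) (t (i + 1)))) *
        ∏ i, arcLength (x i) (x (i + 1)) ^ (β * arcLength (t i) (t (i + 1)) - 1)) with hDdef
  have hD : Measurable D := by
    refine Measurable.ennreal_ofReal (measurable_const.mul (Finset.measurable_prod _ fun i _ => ?_))
    exact (measurable_arcLength_pi i (i + 1)).pow_const _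
  refine Measure.ext fun B hB => ?_
  have hB' := k.measurable_pi_map hB
  have hset : (fun (x : Fin (n + 1) → UnitAddCircle) i => h (x i)) ⁻¹'
      ((fun (x : Fin (n + 1) → UnitAddCircle) i => k (x i)) ⁻¹' B ∩ {x | IsOrderedFamily x}) =
      B ∩ {x | IsOrderedFamily x} := by
    ext x
    simp only [mem_inter_iff, mem_preimage, mem_ofPred_eq, hkh, hh.isOrderedFamily_map_iff]
  rw [Measure.map_apply k.measurable_pi_map hB, withDensity_apply _ hB', withDensity_apply _ hB,
    restrict_withDensity hB, lintegral_withDensity_eq_lintegral_mul _ hD hR,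
    Measure.restrict_restrict hB, Measure.restrict_restrict hB']
  -- Lebesgue measure is replaced by the image under `h` of its multiple with density `∏ h'`, on the
  -- left-hand side only.
  conv_lhs => rw [← hh.map_pi_withDensity_derivative]
  rw [setLIntegral_map (hB'.inter hO) hD h.measurable_pi_map, hset,
    restrict_withDensity (hB.inter hO)]
  change ∫⁻ x, (D ∘ fun (x : Fin (n + 1) → UnitAddCircle) i => h (x i)) x ∂_ = _
  rw [lintegral_withDensity_eq_lintegral_mul _
      h.measurable_prod_derivative (hD.comp h.measurable_pi_map)]
  refine lintegral_congr fun x => ?_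
  have hpos := fun i => (hh.derivative_pos (x i)).le
  have hratio : ∀ i, (arcLength (h (x i)) (h (x (i + 1)))) ^
      (β * arcLength (t i) (t (i + 1)) - 1) =
      (arcLength (h (x i)) (h (x (i + 1))) / arcLength (x i) (x (i + 1))) ^
        (β * arcLength (t i) (t (i + 1)) - 1) *
      arcLength (x i) (x (i + 1)) ^ (β * arcLength (t i) (t (i + 1)) - 1) := fun i => by
    have h1 := arcLength_pos (x i) (x (i + 1))
    rw [← Real.mul_rpow (div_nonneg (arcLength_pos _ _).le h1.le) h1.le,
      div_mul_cancel₀ _ h1.ne']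
  have hR0 : 0 ≤ marginalRatio β h t x :=
    mul_nonneg (Finset.prod_nonneg fun i _ => hpos i) (Finset.prod_nonneg fun i _ =>
      Real.rpow_nonneg (div_nonneg (arcLength_pos _ _).le (arcLength_pos _ _).le) _)
  simp only [Pi.mul_apply, Function.comp_apply]
  rw [← ENNReal.ofReal_prod_of_nonneg fun i _ => hpos i, mul_comm (D x), hDdef,
    ← ENNReal.ofReal_mul (Finset.prod_nonneg fun i _ => hpos i), ← ENNReal.ofReal_mul hR0,
    Finset.prod_congr rfl fun i _ => hratio i, Finset.prod_mul_distrib, marginalRatio]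
  congr 1
  ring

end CircleMonotoneMap

/-! ### Uniform partitions of the circle -/

/-- The points `i / (n + 1)` of the circle. -/
noncomputable def gridPoint (n : ℕ) (i : Fin (n + 1)) : UnitAddCircle :=
  (((i : ℕ) : ℝ) / ((n : ℝ) + 1) : ℝ)

theorem gridPoint_succ (n : ℕ) (i : Fin (n + 1)) :
    gridPoint n (i + 1) = ((((i : ℕ) : ℝ) + 1) / ((n : ℝ) + 1) : ℝ) := by
  have hn : (n : ℝ) + 1 ≠ 0 := by positivity
  by_cases hi : i = Fin.last n
  · subst hi
    rw [Fin.last_add_one, gridPoint, Fin.val_last, div_self hn, AddCircle.coe_period]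
    simp
  · rw [gridPoint, Fin.val_add_one, if_neg hi]
    push_cast
    rfl

theorem arcLength_gridPoint (n : ℕ) (i : Fin (n + 1)) :
    arcLength (gridPoint n i) (gridPoint n (i + 1)) = 1 / ((n : ℝ) + 1) := by
  have hn : (0 : ℝ) < (n : ℝ) + 1 := by positivity
  rw [gridPoint_succ, gridPoint, arcLength_coe]
  · ring
  · gcongr; linarith
  · rw [← sub_le_iff_le_add', ← sub_div, div_le_one hn]
    linarith [(Nat.cast_nonneg n : (0 : ℝ) ≤ n)]

theorem isOrderedFamily_gridPoint (n : ℕ) : IsOrderedFamily (gridPoint n) := by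
  have hn : (n : ℝ) + 1 ≠ 0 := by positivity
  rw [IsOrderedFamily, Finset.sum_congr rfl fun i _ => arcLength_gridPoint n i]
  simp [hn]

theorem exists_ceil_eq {s : ℝ} (hs : s ∈ Ioc (0 : ℝ) 1) (n : ℕ) :
    ∃ i : Fin (n + 1), ⌈((n : ℝ) + 1) * s⌉ = (i : ℕ) + 1 := by
  have hn : (0 : ℝ) < (n : ℝ) + 1 := by positivity
  have h1 : 0 < ⌈((n : ℝ) + 1) * s⌉ := Int.ceil_pos.2 (mul_pos hn hs.1)
  have h2 : ⌈((n : ℝ) + 1) * s⌉ ≤ (n : ℤ) + 1 := by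
    refine Int.ceil_le.2 ?_
    push_cast
    nlinarith [hs.2]
  exact ⟨⟨(⌈((n : ℝ) + 1) * s⌉ - 1).toNat, by omega⟩, by simp only; omega⟩

namespace CircleMonotoneMap

variable {h k : CircleMonotoneMap}

/-- Increments of the lift never exceed the corresponding arc lengths. For an ordered family both
sums equal 1, so equality holds term by term; in particular no increment vanishes. -/
theorem arcLength_gridPoint_of_isOrderedFamily {g : CircleMonotoneMap} {n : ℕ}
    (hg : IsOrderedFamily fun i => g (gridPoint n i)) (i : Fin (n + 1)) :
    arcLength (g (gridPoint n i)) (g (gridPoint n (i + 1))) =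
      g.lift ((((i : ℕ) : ℝ) + 1) / ((n : ℝ) + 1)) - g.lift (((i : ℕ) : ℝ) / ((n : ℝ) + 1)) := by
  have hn : (0 : ℝ) < (n : ℝ) + 1 := by positivity
  have hle : ∀ i ∈ (Finset.univ : Finset (Fin (n + 1))),
      g.lift ((((i : ℕ) : ℝ) + 1) / ((n : ℝ) + 1)) - g.lift (((i : ℕ) : ℝ) / ((n : ℝ) + 1)) ≤
      arcLength (g (gridPoint n i)) (g (gridPoint n (i + 1))) := fun i _ => by
    have h1 : g.lift (((i : ℕ) : ℝ) / ((n : ℝ) + 1)) ≤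
        g.lift ((((i : ℕ) : ℝ) + 1) / ((n : ℝ) + 1)) :=
      g.lift_spec.1.mono (by gcongr; linarith)
    have h2 := g.lift_grid_sub_le_one n i
    push_cast at h2
    rw [gridPoint_succ, gridPoint, ← g.coe_lift, ← g.coe_lift]
    rcases h1.eq_or_lt with h1 | h1
    · rw [h1, sub_self]; exact (arcLength_pos _ _).le
    · rw [arcLength_coe h1 (by linarith)]
  have hsum : ∑ i : Fin (n + 1), (g.lift ((((i : ℕ) : ℝ) + 1) / ((n : ℝ) + 1)) -
      g.lift (((i : ℕ) : ℝ) / ((n : ℝ) + 1))) = 1 := by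
    rw [Fin.sum_univ_eq_sum_range (fun i => g.lift (((i : ℝ) + 1) / ((n : ℝ) + 1)) -
      g.lift ((i : ℝ) / ((n : ℝ) + 1)))]
    have h1 := Finset.sum_range_sub (fun i : ℕ => g.lift ((i : ℝ) / ((n : ℝ) + 1))) (n + 1)
    rw [lift_grid_last] at h1
    push_cast at h1
    rw [h1]; ring
  exact ((Finset.sum_eq_sum_iff_of_le hle).1 (hsum.trans hg.symm) i (Finset.mem_univ i)).symm

/-- The mean of the logarithms of the difference quotients of `h` along `g`. -/
noncomputable def logSlopeMean (h g : CircleMonotoneMap) (n : ℕ) : ℝ :=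
  ∑ i ∈ Finset.range (n + 1), 1 / ((n : ℝ) + 1) *
    Real.log ((h.lift (g.lift (((i : ℝ) + 1) / ((n : ℝ) + 1))) -
      h.lift (g.lift ((i : ℝ) / ((n : ℝ) + 1)))) /
      (g.lift (((i : ℝ) + 1) / ((n : ℝ) + 1)) - g.lift ((i : ℝ) / ((n : ℝ) + 1))))

/-- In the exponent `β / (n + 1) - 1`, the first part yields the mean of the log slopes, while the
`-1` supplies the denominators of the factors in `logFactorSum`. -/
theorem IsC2Diffeo.marginalRatio_eq_exp (hh : h.IsC2Diffeo) (β : ℝ) {g : CircleMonotoneMap} {n : ℕ}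
    (hg : IsOrderedFamily fun i => g (gridPoint n i)) :
    marginalRatio β h (gridPoint n) (fun i => g (gridPoint n i)) =
      Real.exp (β * h.logSlopeMean g n + h.logFactorSum g n) := by
  have harc := arcLength_gridPoint_of_isOrderedFamily hg
  set w : ℕ → ℝ := fun i => g.lift ((i : ℝ) / ((n : ℝ) + 1)) with hw
  have hw1 : ∀ i : ℕ, g.lift (((i : ℝ) + 1) / ((n : ℝ) + 1)) = w (i + 1) := fun i => by
    simp only [hw]; push_cast; rfl
  have hw0 : ∀ i : ℕ, g.lift ((i : ℝ) / ((n : ℝ) + 1)) = w i := fun i => rfl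
  simp only [hw1, hw0] at harc
  have hlt : ∀ i < n + 1, w i < w (i + 1) := fun i hi => by
    have h1 := harc ⟨i, hi⟩
    have h2 := arcLength_pos (g (gridPoint n ⟨i, hi⟩)) (g (gridPoint n (⟨i, hi⟩ + 1)))
    rw [h1] at h2
    simpa using h2
  have hle : ∀ i, w (i + 1) - w i ≤ 1 := fun i => g.lift_grid_sub_le_one n i
  have hmap : ∀ i : Fin (n + 1), arcLength (h (g (gridPoint n i))) (h (g (gridPoint n (i + 1)))) =
      h.lift (w (i + 1)) - h.lift (w i) := fun i => by
    rw [gridPoint_succ, gridPoint, ← g.coe_lift, ← g.coe_lift, hw1, hw0,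
      hh.arcLength_map (hlt i i.2) (by linarith [hle i])]
  have hder : ∀ i : Fin (n + 1), h.derivative (g (gridPoint n i)) =
      Real.exp (h.logDeriv (w i)) := fun i => by
    rw [gridPoint, ← g.coe_lift, hw0, derivative_coe, logDeriv, Real.exp_log (hh.deriv_pos _)]
  set S : ℕ → ℝ := fun i => Real.log ((h.lift (w (i + 1)) - h.lift (w i)) / (w (i + 1) - w i))
    with hS
  have hpow : ∀ i : Fin (n + 1), ((h.lift (w (i + 1)) - h.lift (w i)) / (w (i + 1) - w i)) ^
      (β * (1 / ((n : ℝ) + 1)) - 1) =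
      Real.exp (S i * (β * (1 / ((n : ℝ) + 1)) - 1)) := fun i => by
    rw [Real.rpow_def_of_pos (hh.slope_pos (hlt i i.2).ne)]
  have hfac : h.logFactorSum g n = ∑ i ∈ Finset.range (n + 1),
      ((h.logDeriv (w i) + h.logDeriv (w (i + 1))) / 2 - S i) := by
    refine Finset.sum_congr rfl fun i hi => ?_
    rw [hw1, hw0, hh.logFactor_eq (hlt i (Finset.mem_range.1 hi)).ne]
  -- By periodicity of `log h'`, evaluating at left endpoints or averaging over both endpoints gives
  -- the same sum.
  have htel : ∑ i ∈ Finset.range (n + 1), (h.logDeriv (w (i + 1)) - h.logDeriv (w i)) = 0 := by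
    rw [Finset.sum_range_sub (fun i => h.logDeriv (w i)), sub_eq_zero]
    have h1 : w (n + 1) = w 0 + ((1 : ℤ) : ℝ) := by
      rw [Int.cast_one]; exact g.lift_grid_last n
    rw [h1, logDeriv_add_int]
  have hmean : h.logSlopeMean g n = ∑ i ∈ Finset.range (n + 1), 1 / ((n : ℝ) + 1) * S i := by
    refine Finset.sum_congr rfl fun i _ => ?_
    rw [hw1, hw0]
  rw [marginalRatio]
  simp only [arcLength_gridPoint, hmap, harc, hder, hpow]
  rw [← Real.exp_sum, ← Real.exp_sum, ← Real.exp_add,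
    Fin.sum_univ_eq_sum_range (fun i => h.logDeriv (w i)),
    Fin.sum_univ_eq_sum_range (fun i => S i * (β * (1 / ((n : ℝ) + 1)) - 1)), hfac, hmean,
    Finset.mul_sum, ← Finset.sum_add_distrib, ← Finset.sum_add_distrib]
  congr 1
  rw [← sub_eq_zero, ← Finset.sum_sub_distrib, ← mul_zero (-(1 / 2 : ℝ)), ← htel, Finset.mul_sum]
  exact Finset.sum_congr rfl fun i _ => by ring

theorem IsC2Diffeo.exists_log_slope_bound (hh : h.IsC2Diffeo) :
    ∃ C, 0 ≤ C ∧ ∀ x y, x ≤ y → |Real.log ((h.lift y - h.lift x) / (y - x))| ≤ C := by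
  obtain ⟨C, hC0, hC⟩ := hh.exists_bound_logDeriv
  refine ⟨C, hC0, fun x y hxy => ?_⟩
  rcases hxy.eq_or_lt with rfl | hxy
  · simpa using hC0
  · obtain ⟨ξ, -, h1⟩ := exists_deriv_eq_slope h.lift hxy hh.continuous.continuousOn
      hh.differentiable.differentiableOn
    rw [← h1]
    exact hC ξ

theorem IsC2Diffeo.exists_marginalRatio_bound (hh : h.IsC2Diffeo) (β : ℝ) :
    ∃ C : ℝ, ∀ (g : CircleMonotoneMap) (n : ℕ), IsOrderedFamily (fun i => g (gridPoint n i)) →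
      marginalRatio β h (gridPoint n) (fun i => g (gridPoint n i)) ≤ C := by
  obtain ⟨A, hA0, hA⟩ := hh.exists_log_slope_bound
  obtain ⟨B, hB0, hB⟩ := hh.exists_logFactorSum_bound
  refine ⟨Real.exp (|β| * A + B), fun g n hg => ?_⟩
  rw [hh.marginalRatio_eq_exp β hg, Real.exp_le_exp]
  have hn : (0 : ℝ) < (n : ℝ) + 1 := by positivity
  have h1 : |h.logSlopeMean g n| ≤ A := by
    refine (Finset.abs_sum_le_sum_abs _ _).trans ((Finset.sum_le_sum
      (g := fun _ => 1 / ((n : ℝ) + 1) * A) fun i _ => ?_).trans_eq ?_)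
    · rw [abs_mul, abs_of_pos (by positivity : 0 < 1 / ((n : ℝ) + 1))]
      exact mul_le_mul_of_nonneg_left (hA _ _ (g.lift_spec.1.mono (by gcongr; linarith)))
        (by positivity)
    · rw [Finset.sum_const, Finset.card_range, nsmul_eq_mul]
      push_cast
      field_simp
  refine add_le_add ((le_abs_self _).trans ?_) ((le_abs_self _).trans (hB g n))
  rw [abs_mul]
  exact mul_le_mul_of_nonneg_left h1 (abs_nonneg β)

/-- Stieltjes sums for Lebesgue measure: at a continuity point of the lift both cell ends have
values tending to `g.lift s`, so the log slope of `h` between them tends to `log h'` there. -/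
theorem IsC2Diffeo.tendsto_logSlopeMean (hh : h.IsC2Diffeo) {g : CircleMonotoneMap}
    (hg : ∀ n, IsOrderedFamily fun i => g (gridPoint n i)) :
    Tendsto (h.logSlopeMean g) atTop
      (𝓝 (∫ s : UnitAddCircle, Real.log (h.derivative (g s)))) := by
  have hG := g.lift_spec.1
  obtain ⟨A, hA0, hA⟩ := hh.exists_log_slope_bound
  obtain ⟨C, hC0, hC⟩ := hh.exists_slope_bound
  have hcont : ∀ᵐ s ∂(volume : Measure ℝ), Function.leftLim g.lift s = g.lift s := by
    have h1 := (hG.stieltjes.countable_leftLim_ne).ae_notMem (volume : Measure ℝ)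
    filter_upwards [h1] with s hs
    exact not_not.1 hs
  have key := StieltjesFunction.id.tendsto_sum_grid
    (φ := fun x y => Real.log ((h.lift (g.lift y) - h.lift (g.lift x)) / (g.lift y - g.lift x)))
    (F := fun s => h.logDeriv (g.lift s)) (C := A) (fun x y hxy => hA _ _ (hG.mono hxy)) (by
      rw [← Real.volume_eq_stieltjes_id, ae_restrict_iff' measurableSet_Ioc]
      filter_upwards [hcont] with s hs hs01
      have hl := hG.tendsto_gridLeft s
      have hr := hG.tendsto_gridRight s
      rw [hs] at hl
      -- Strictness is needed: for equal values the quotient is `0 / 0` and its logarithm 0,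
      -- unrelated to `log h'`. It holds because the family is ordered.
      have hlt : ∀ n, g.lift (gridLeft n s) < g.lift (gridRight n s) := fun n => by
        obtain ⟨i, hi⟩ := exists_ceil_eq hs01 n
        have h1 := arcLength_gridPoint_of_isOrderedFamily (hg n) i
        have h2 := arcLength_pos (g (gridPoint n i)) (g (gridPoint n (i + 1)))
        rw [h1, sub_pos] at h2
        rw [gridLeft, gridRight, hi]
        push_cast
        rwa [add_sub_cancel_right]
      have hd : Tendsto (fun n => C * (g.lift (gridRight n s) - g.lift (gridLeft n s))) atTop
          (𝓝 0) := by
        simpa using (hr.sub hl).const_mul C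
      have h3 := squeeze_zero_norm (f := fun n => Real.log
        ((h.lift (g.lift (gridRight n s)) - h.lift (g.lift (gridLeft n s))) /
          (g.lift (gridRight n s) - g.lift (gridLeft n s))) - h.logDeriv (g.lift (gridLeft n s)))
        (fun n => (hC _ _ (hlt n)).1) hd
      have h4 := h3.add ((hh.contDiff_logDeriv.continuous.tendsto _).comp hl)
      simpa using h4)
  rw [← Real.volume_eq_stieltjes_id] at key
  have hint : ∫ s : UnitAddCircle, Real.log (h.derivative (g s)) =
      ∫ s in Ioc (0 : ℝ) 1, h.logDeriv (g.lift s) := by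
    rw [← UnitAddCircle.integral_preimage 0, zero_add]
    simp only [← coe_lift, log_derivative_coe]
  rw [hint]
  refine key.congr fun n => Finset.sum_congr rfl fun i _ => ?_
  congr 1
  change ((i : ℝ) + 1) / ((n : ℝ) + 1) - (i : ℝ) / ((n : ℝ) + 1) = _
  ring

theorem IsC2Diffeo.tendsto_marginalRatio (hh : h.IsC2Diffeo) (β : ℝ) {g : CircleMonotoneMap}
    (hg : ∀ n, IsOrderedFamily fun i => g (gridPoint n i)) :
    Tendsto (fun n => marginalRatio β h (gridPoint n) (fun i => g (gridPoint n i))) atTop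
      (𝓝 (densityY β h g)) := by
  simp only [fun n => hh.marginalRatio_eq_exp β (hg n), Real.exp_add]
  exact ((Real.continuous_exp.tendsto _).comp
    ((hh.tendsto_logSlopeMean hg).const_mul β)).mul (hh.tendsto_exp_logFactorSum g)

/-! ### Quasi-invariance of the Dirichlet process -/

/-- The evaluation at the points `i / (n + 1)`. -/
noncomputable def gridEval (n : ℕ) (g : CircleMonotoneMap) (i : Fin (n + 1)) : UnitAddCircle :=
  g (gridPoint n i)

theorem measurable_gridEval (n : ℕ) : Measurable (gridEval n) :=
  measurable_pi_lambda _ fun i => measurable_eval (gridPoint n i)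

theorem exists_gridEval_eq_comp {m n : ℕ} (hmn : (m + 1) ∣ (n + 1)) :
    ∃ P : (Fin (n + 1) → UnitAddCircle) → (Fin (m + 1) → UnitAddCircle), Measurable P ∧
      gridEval m = P ∘ gridEval n := by
  obtain ⟨c, hc⟩ := hmn
  have hc0 : 0 < c := Nat.pos_of_ne_zero fun h0 => by simp [h0] at hc
  have hi : ∀ i : Fin (m + 1), i * c < n + 1 := fun i => by
    rw [hc]; exact Nat.mul_lt_mul_of_pos_right i.2 hc0
  refine ⟨fun x i => x ⟨i * c, hi i⟩, measurable_pi_lambda _ fun i => measurable_pi_apply _, ?_⟩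
  funext g i
  simp only [gridEval, Function.comp_apply, gridPoint]
  congr 2
  have hc' : (n : ℝ) + 1 = ((m : ℝ) + 1) * c := by exact_mod_cast hc
  have hm : (m : ℝ) + 1 ≠ 0 := by positivity
  have hc1 : (c : ℝ) ≠ 0 := by exact_mod_cast hc0.ne'
  rw [hc']
  push_cast
  field_simp

theorem comap_gridEval_le {m n : ℕ} (hmn : (m + 1) ∣ (n + 1)) :
    MeasurableSpace.comap (gridEval m) MeasurableSpace.pi ≤
      MeasurableSpace.comap (gridEval n) MeasurableSpace.pi := by
  obtain ⟨P, hP, he⟩ := exists_gridEval_eq_comp hmn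
  rw [he, ← MeasurableSpace.comap_comp]
  exact MeasurableSpace.comap_mono hP.comap_le

/-- By right continuity, `g(s)` is the limit of the values at the grid points `gridRight n s`. -/
theorem iSup_comap_gridEval :
    ⨆ n, MeasurableSpace.comap (gridEval n) MeasurableSpace.pi = instMeasurableSpace := by
  refine le_antisymm (iSup_le fun n => (measurable_gridEval n).comap_le) ?_
  rw [instMeasurableSpace, ← measurable_iff_comap_le]
  refine @measurable_pi_lambda _ _ _ (_) _ _ fun t => ?_
  obtain ⟨s, hs, rfl⟩ : ∃ s ∈ Ioc (0 : ℝ) 1, (s : UnitAddCircle) = t :=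
    ⟨AddCircle.equivIoc (1 : ℝ) 0 t, by simpa using (AddCircle.equivIoc (1 : ℝ) 0 t).2,
      AddCircle.coe_equivIoc⟩
  refine @measurable_of_tendsto_metrizable _ _ (_) _ _ _ _
    (fun n (g : CircleMonotoneMap) => g (gridRight n s : UnitAddCircle)) _ (fun n => ?_) ?_
  · obtain ⟨i, hi⟩ := exists_ceil_eq hs n
    have h1 : (gridRight n s : UnitAddCircle) = gridPoint n (i + 1) := by
      rw [gridPoint_succ, gridRight, hi]; push_cast; rfl
    have h2 : Measurable[MeasurableSpace.comap (gridEval n) MeasurableSpace.pi]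
        fun g : CircleMonotoneMap => g (gridPoint n (i + 1)) :=
      (measurable_pi_apply (i + 1)).comp (comap_measurable (gridEval n))
    rw [h1]
    exact h2.mono (le_iSup (fun n => MeasurableSpace.comap (gridEval n) MeasurableSpace.pi) n)
      le_rfl
  · refine tendsto_pi_nhds.2 fun g => ?_
    simp only [← coe_lift]
    exact ((AddCircle.continuous_mk' (1 : ℝ)).tendsto _).comp (g.lift_spec.1.tendsto_gridRight s)

theorem isPiSystem_gridEval :
    IsPiSystem (⋃ n, {A | MeasurableSet[MeasurableSpace.comap (gridEval n) MeasurableSpace.pi] A}) := by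
  refine isPiSystem_iUnion_of_directed_le _
    (fun n => @MeasurableSpace.isPiSystem_measurableSet _ (_)) fun m n => ?_
  -- This index has successor `(m + 1) * (n + 1)`, so its grid refines both given ones.
  refine ⟨(m + 1) * n + m, fun A hA => ?_, fun A hA => ?_⟩
  · exact comap_gridEval_le (Dvd.intro (n + 1) (by ring)) A hA
  · exact comap_gridEval_le (Dvd.intro (m + 1) (by ring)) A hA

variable {β : ℝ} {Q : Measure CircleMonotoneMap}

theorem IsDirichletProcess.ae_isOrderedFamily (hQ : IsDirichletProcess β Q) :
    ∀ᵐ g ∂Q, ∀ n, IsOrderedFamily fun i => g (gridPoint n i) := by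
  rw [ae_all_iff]
  intro n
  have h1 : ∀ᵐ x ∂Q.map (gridEval n), IsOrderedFamily x := by
    rw [show Q.map (gridEval n) = dirichletMarginal β (gridPoint n) from
      hQ.marginal n (gridPoint n) (isOrderedFamily_gridPoint n)]
    exact (withDensity_absolutelyContinuous _ _).ae_le
      (ae_restrict_mem measurableSet_isOrderedFamily)
  exact ae_of_ae_map (measurable_gridEval n).aemeasurable h1

theorem IsDirichletProcess.map_translate_apply (hQ : IsDirichletProcess β Q) (hh : h.IsC2Diffeo)
    (hk : k.comp h = identity) (n : ℕ) {B : Set (Fin (n + 1) → UnitAddCircle)}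
    (hB : MeasurableSet B) :
    Q.map k.translate (gridEval n ⁻¹' B) = ∫⁻ g in gridEval n ⁻¹' B,
      ENNReal.ofReal (marginalRatio β h (gridPoint n) (gridEval n g)) ∂Q := by
  have hmarg : Q.map (gridEval n) = dirichletMarginal β (gridPoint n) :=
    hQ.marginal n (gridPoint n) (isOrderedFamily_gridPoint n)
  have hE := measurable_gridEval n
  rw [Measure.map_apply (measurable_translate k) (hE hB)]
  have h1 : k.translate ⁻¹' (gridEval n ⁻¹' B) =
      gridEval n ⁻¹' ((fun x i => k (x i)) ⁻¹' B) := rfl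
  rw [h1, ← Measure.map_apply hE (k.measurable_pi_map hB), hmarg,
    ← Measure.map_apply k.measurable_pi_map hB, hh.map_dirichletMarginal hk,
    withDensity_apply _ hB, ← hmarg,
    setLIntegral_map hB (measurable_marginalRatio β h (gridPoint n)).ennreal_ofReal hE]

/-- Both measures are compared on events determined by a fixed grid `m`. Along refinements of it the
left side stays constant, while the marginal densities on the right converge boundedly to
`densityY`. -/
theorem IsDirichletProcess.map_translate (hQ : IsDirichletProcess β Q) (hh : h.IsC2Diffeo)
    (hk : k.comp h = identity) :
    Q.map k.translate = Q.withDensity fun g => ENNReal.ofReal (densityY β h g) := by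
  have hprob := hQ.isProbabilityMeasure
  have hprob' : IsProbabilityMeasure (Q.map k.translate) :=
    Measure.isProbabilityMeasure_map (measurable_translate k).aemeasurable
  have key : ∀ A ∈ ⋃ n, {A | MeasurableSet[MeasurableSpace.comap (gridEval n) MeasurableSpace.pi] A},
      Q.map k.translate A = (Q.withDensity fun g => ENNReal.ofReal (densityY β h g)) A := by
    intro A hA
    obtain ⟨m, B, hB, rfl⟩ := mem_iUnion.1 hA
    rw [withDensity_apply _ (measurable_gridEval m hB)]
    obtain ⟨C, hC⟩ := hh.exists_marginalRatio_bound β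
    -- `N j + 1 = (m + 1) * (j + 1)`, so all these grids contain the grid of index `m`.
    let N : ℕ → ℕ := fun j => (m + 1) * j + m
    have hN : Tendsto N atTop atTop :=
      tendsto_atTop_mono (fun j => by simp only [N, id]; nlinarith [Nat.zero_le (m * j)]) tendsto_id
    have hlim : Tendsto (fun j => ∫⁻ g in gridEval m ⁻¹' B,
        ENNReal.ofReal (marginalRatio β h (gridPoint (N j)) (gridEval (N j) g)) ∂Q) atTop
        (𝓝 (∫⁻ g in gridEval m ⁻¹' B, ENNReal.ofReal (densityY β h g) ∂Q)) := by
      refine tendsto_lintegral_of_dominated_convergence (fun _ => ENNReal.ofReal C)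
        (fun j => ?_) (fun j => ?_) ?_ ?_
      · exact (measurable_marginalRatio β h (gridPoint (N j))).ennreal_ofReal.comp
          (measurable_gridEval (N j))
      · filter_upwards [ae_restrict_of_ae hQ.ae_isOrderedFamily] with g hg
        exact ENNReal.ofReal_le_ofReal (hC g (N j) (hg (N j)))
      · rw [lintegral_const]
        exact ENNReal.mul_ne_top ENNReal.ofReal_ne_top (measure_ne_top _ _)
      · filter_upwards [ae_restrict_of_ae hQ.ae_isOrderedFamily] with g hg
        exact (ENNReal.continuous_ofReal.tendsto _).comp
          ((hh.tendsto_marginalRatio β hg).comp hN)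
    refine tendsto_nhds_unique (tendsto_const_nhds.congr fun j => ?_) hlim
    obtain ⟨P, hP, he⟩ := exists_gridEval_eq_comp (m := m) (n := N j)
      (Dvd.intro (j + 1) (by simp only [N]; ring))
    rw [he, preimage_comp]
    exact hQ.map_translate_apply hh hk (N j) (hP hB)
  refine ext_of_generate_finite _ (iSup_comap_gridEval.symm.trans
    (MeasurableSpace.generateFrom_iUnion_measurableSet _).symm) isPiSystem_gridEval key (key _ ?_)
  exact mem_iUnion.2 ⟨0, @MeasurableSet.univ _ (MeasurableSpace.comap (gridEval 0) _)⟩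

/-! ### Absolute continuity and the entropic measure -/

theorem IsC2Diffeo.densityY_pos (hh : h.IsC2Diffeo) (β : ℝ) (g : CircleMonotoneMap) :
    0 < densityY β h g := by
  rw [densityY, densityX, hh.densityY0_eq_exp]
  positivity

/-- A strictly positive density makes `Q` and its image under `k` equivalent; pushing both forward
by `h` gives the claim for `h`, since `h` undoes `k`. -/
theorem IsDirichletProcess.absolutelyContinuous (hQ : IsDirichletProcess β Q) (hh : h.IsC2Diffeo)
    (hk : k.comp h = identity) (hk' : h.comp k = identity) :
    Q.map h.translate ≪ Q ∧ Q ≪ Q.map h.translate := by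
  have hmap : (Q.map k.translate).map h.translate = Q := by
    rw [Measure.map_map (measurable_translate h) (measurable_translate k)]
    convert Measure.map_id
    funext g
    exact ext_fun fun x => congrFun (congrArg toFun hk') (g x)
  have h1 : Q.map k.translate ≪ Q := by
    rw [hQ.map_translate hh hk]; exact withDensity_absolutelyContinuous _ _
  have h2 : Q ≪ Q.map k.translate := by
    rw [hQ.map_translate hh hk]
    refine withDensity_absolutelyContinuous' (hh.measurable_densityY β).ennreal_ofReal.aemeasurable
      (Eventually.of_forall fun g => ?_)
    simpa using hh.densityY_pos β g
  refine ⟨?_, ?_⟩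
  · have := h2.map (measurable_translate h)
    rwa [hmap] at this
  · have := h1.map (measurable_translate h)
    rwa [hmap] at this

theorem chi_translate (h g : CircleMonotoneMap) : (h.translate g).chi = h.pushforward g.chi := by
  apply Subtype.ext
  change Measure.map (h.translate g) volume = Measure.map h (Measure.map g volume)
  rw [Measure.map_map h.measurable_coe g.measurable_coe]
  rfl

theorem entropicMeasure_map_pushforward (h : CircleMonotoneMap) (Q : Measure CircleMonotoneMap) :
    (entropicMeasure Q).map h.pushforward = (Q.map h.translate).map chi := by
  rw [entropicMeasure, Measure.map_map (measurable_pushforward h) measurable_chi,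
    Measure.map_map measurable_chi (measurable_translate h)]
  congr 1
  funext g
  exact (chi_translate h g).symm

theorem IsDirichletProcess.entropicMeasure_map (hQ : IsDirichletProcess β Q) (hh : h.IsC2Diffeo)
    (hk : k.comp h = identity) :
    (entropicMeasure Q).map k.pushforward =
      (entropicMeasure Q).withDensity fun μ => ENNReal.ofReal (entropicDensity β h μ) := by
  rw [entropicMeasure_map_pushforward, hQ.map_translate hh hk]
  refine Measure.ext fun A hA => ?_
  rw [Measure.map_apply measurable_chi hA, withDensity_apply _ (measurable_chi hA),
    withDensity_apply _ hA, entropicMeasure,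
    setLIntegral_map hA (hh.measurable_entropicDensity β).ennreal_ofReal measurable_chi]
  simp only [hh.densityY_eq]

theorem IsC2Diffeo.bijective_translate (hk : k.comp h = identity) (hk' : h.comp k = identity) :
    Function.Bijective h.translate := by
  refine Function.bijective_iff_has_inverse.2 ⟨k.translate, fun g => ?_, fun g => ?_⟩
  · exact ext_fun fun x => congrFun (congrArg toFun hk) (g x)
  · exact ext_fun fun x => congrFun (congrArg toFun hk') (g x)

end CircleMonotoneMap

theorem mainTheorem1 (β : ℝ) (hβ : 0 < β) (h : CircleMonotoneMap) (hh : h.IsC2Diffeo) :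
    Function.Bijective h.translate ∧
    (∀ g : CircleMonotoneMap, Multipliable fun a : g.jumps => h.jumpFactor g a) ∧
    (∀ μ : ProbabilityMeasure UnitAddCircle,
      Multipliable fun I : CircleMonotoneMap.gaps μ => h.gapFactor I) ∧
    Measurable (CircleMonotoneMap.densityY β h) ∧
    Measurable (CircleMonotoneMap.entropicDensity β h) ∧
    (∃ C : ℝ, 0 < C ∧ ∀ g : CircleMonotoneMap,
      1 / C ≤ CircleMonotoneMap.densityY β h g ∧ CircleMonotoneMap.densityY β h g ≤ C) ∧
    (∀ g : CircleMonotoneMap,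
      CircleMonotoneMap.densityY β h g = CircleMonotoneMap.entropicDensity β h g.chi) ∧
    ∃ hinv : CircleMonotoneMap,
      hinv.comp h = CircleMonotoneMap.identity ∧ h.comp hinv = CircleMonotoneMap.identity ∧
      hinv.IsC2Diffeo ∧
      ∀ Q : Measure CircleMonotoneMap, CircleMonotoneMap.IsDirichletProcess β Q →
        (Q.map hinv.translate =
          Q.withDensity fun g => ENNReal.ofReal (CircleMonotoneMap.densityY β h g)) ∧
        (Q.map h.translate ≪ Q ∧ Q ≪ Q.map h.translate) ∧
        ((CircleMonotoneMap.entropicMeasure Q).map hinv.pushforward =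
          (CircleMonotoneMap.entropicMeasure Q).withDensity fun μ =>
            ENNReal.ofReal (CircleMonotoneMap.entropicDensity β h μ)) ∧
        ((CircleMonotoneMap.entropicMeasure Q).map h.pushforward ≪
            CircleMonotoneMap.entropicMeasure Q ∧
          CircleMonotoneMap.entropicMeasure Q ≪
            (CircleMonotoneMap.entropicMeasure Q).map h.pushforward) := by
  obtain ⟨k, hk, hk', hkd⟩ := hh.exists_inv
  refine ⟨CircleMonotoneMap.IsC2Diffeo.bijective_translate hk hk', hh.multipliable_jumpFactor,
    fun μ => hh.multipliable_gapFactor μ, hh.measurable_densityY β,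
    hh.measurable_entropicDensity β, hh.exists_densityY_bound hβ, hh.densityY_eq β,
    k, hk, hk', hkd, fun Q hQ => ?_⟩
  obtain ⟨h1, h2⟩ := hQ.absolutelyContinuous hh hk hk'
  refine ⟨hQ.map_translate hh hk, ⟨h1, h2⟩, hQ.entropicMeasure_map hh hk, ?_⟩
  rw [CircleMonotoneMap.entropicMeasure_map_pushforward]
  exact ⟨h1.map CircleMonotoneMap.measurable_chi, h2.map CircleMonotoneMap.measurable_chi⟩
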